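/- **Logic and traces.** Let $AP$ be a set. Formulas are $\phi ::= p \mid \neg p \mid \phi\wedge\phi \mid \phi\vee\phi \mid \phi\,U_{\bowtie n}\,\phi \mid \phi\,R_{\bowtie n}\,\phi \mid F_{\bowtie n}\phi \mid G_{\bowtie n}\phi$ with $p\in AP$, $n\in\mathbb N$, ${\bowtie}\in\{<,\le,\ge,>\}$ (positive normal form); $F_{\bowtie n}\phi$ and $G_{\bowtie n}\phi$ mean $\mathbf{true}\,U_{\bowtie n}\phi$ and $\mathbf{false}\,R_{\bowtie n}\phi$; $U^s=U_{\ge 0}$, $R^s=R_{\ge 0}$. A *super-dense timed trace* is a sequence $\sigma=(I_i,v_i)_{i\in\mathbb N}$ with $v_i\subseteq AP$, where each $I_i$ is a singleton $[T,T]$ with $T\ge 0$ or an open interval $(T,T')$ with $0\le T<T'$; $I_0=[0,0]$; $I_i=(T,T')$ implies $I_{i+1}=[T',T']$; $I_i=[T,T]$ implies that $I_{i+1}$ is $[T,T]$ or $(T,T')$ for some $T'$; and every $t\ge 0$ lies in some $I_i$. Its points are the pairs $(i,t)$ with $t\in I_i$, and $(i,t)\prec(i',t')$ iff $i<i'$,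 or $i=i'$ and $t<t'$. Satisfaction $\sigma^{(i,t)}\models\phi$ is defined by $p\in v_i$ for $p$, $p\notin v_i$ for $\neg p$, the usual clauses for $\wedge,\vee$, and: $\phi U_{\bowtie n}\psi$ holds at $(i,t)$ iff there is a point $(i',t')\succ(i,t)$ with $t'-t\bowtie n$ at which $\psi$ holds and such that $\phi$ holds at all points strictly between $(i,t)$ and $(i',t')$; $\phi R_{\bowtie n}\psi$ holds at $(i,t)$ iff for every point $(i',t')\succ(i,t)$ with $t'-t\bowtie n$ at which $\psi$ fails, $\phi$ holds at some point strictly between $(i,t)$ and $(i',t')$. **Transition systems.** A *transition system* $\mathcal S=\langle Z,X,\mathcal I,\mathcal{INV},\mathcal T,\mathcal F,\widehat{AP}\rangle$ over $AP$ has finitely many typed non-clock variables $Z$ and non-negative real clocks $X$, formulas $\mathcal I,\mathcal{INV}$ over $Z\cup X$, a formula $\mathcal T$ over the variables in $Z\cup X$, their next-state (primed) versions, a real duration $\delta$ and its next-state version $\delta'$, a finite set $\mathcal F$ of formulas over $Z$, and for each $p\in AP$ a formula $\hat p$ over $Z$. Formulas are quantifier-free; their atoms are arbitrary conditions on non-clock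 variables (primed ones only in $\mathcal T$), the conditions $x\bowtie m$, and, in $\mathcal T$ only, also $x'=0$, $x'=x+\delta$, $x+\delta\bowtie m$, $\delta\bowtie m$, $x'+\delta'\bowtie m$, $\delta'\bowtie m$, with $x\in X$, $m\in\mathbb N$, ${\bowtie}\in\{<,\le,=,\ge,>\}$. It is required that $\mathcal T$ implies $\delta\ge 0$ and, for each $x\in X$, $x'=0$ or $x'=x+\delta$. A *run* consists of states $s_i$ (valuations of $Z\cup X$, with clocks non-negative) and reals $\delta_i\ge 0$, $i\in\mathbb N$, such that $\delta_0=0$; $\delta_i>0$ implies $\delta_{i+1}=0$; $s_0\models\mathcal I$; every $s_i\models\mathcal{INV}$; $\mathcal T$ holds for $(s_i,\delta_i,s_{i+1},\delta_{i+1})$; every $f\in\mathcal F$ holds in infinitely many $s_i$; and $\sum_i\delta_i=\infty$ (non-zenoness). Its trace has $v_i=\{p: s_i\models\hat p\}$ and, with $t_i=\sum_{j<i}\delta_j$, $I_i=[t_i,t_i]$ if $\delta_i=0$ and $I_i=(t_i,t_i+\delta_i)$ if $\delta_i>0$. The set of traces of runs is $\mathrm{traces}(\mathcal S)$. **Sound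 encodings.** In a transition system some Boolean variables are designated as variables $[\psi]$ of formulas $\psi$ (at most one for each $\psi$). A system $\mathcal S'$ is a *sound encoding of $\phi$ for $\mathcal S$* if it has a variable $[\psi]$ for every sub-formula $\psi$ of $\phi$ (the sub-formulas of $F_{\bowtie n}\alpha$ and of $G_{\bowtie n}\alpha$ are the formula itself and those of $\alpha$; $\neg p$ is its own only sub-formula), $\mathrm{traces}(\mathcal S')=\mathrm{traces}(\mathcal S)$, and for every run of $\mathcal S'$ with trace $\sigma$ and every $i$, if $s_i([\phi])=\mathbf{true}$ then $\sigma^{(i,t)}\models\phi$ for all $t\in I_i$. **The encodings.** Given $\mathcal S$, the system $\mathcal S_\phi$ arises from $\mathcal S$ by adding fresh Boolean variables, among them $u=[\phi]$ (which becomes the variable designated for $\phi$), possibly a fresh clock $c$, and by adding conjuncts to $\mathcal T$ and, where stated, to $\mathcal I$ and a formula to $\mathcal F$. Put $o:=(\delta>0)$, $o':=(\delta'>0)$. For unary operators $r=[\alpha]$; for binary ones $l=[\alpha]$, $r=[\beta]$. The added conjuncts of $\mathcal T$ are: * $p$: $u\Leftrightarrow\hat p$. $\neg p$: $u\Leftrightarrow\neg\hat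 p$. $\alpha\wedge\beta$: $u\Leftrightarrow(l\wedge r)$. $\alpha\vee\beta$: $u\Leftrightarrow(l\vee r)$. * $\alpha U^s\beta$: $u\wedge o\Rightarrow l\wedge(r\vee r'\vee(l'\wedge u'))$; $u\wedge\neg o\Rightarrow(\neg o'\wedge r')\vee(l'\wedge u')$. Fairness: $\neg u\vee r$. * $F_{\le 0}\alpha$: $u\Rightarrow\neg o\wedge\neg o'\wedge(r'\vee u')$. * $F_{<n}\alpha$, $F_{\le n}\alpha$ ($n>0$), fresh Boolean $\mathit{lefto}$, clock $c$, initially $c=0\wedge\neg\mathit{lefto}$; with $\rho:=(\neg u\vee(o\wedge r)\vee r')\wedge u'$: $u\wedge o\Rightarrow r\vee r'\vee u'$; $u\wedge\neg o\Rightarrow r'\vee u'$; $\rho\Rightarrow c'=0\wedge(\mathit{lefto}'\Leftrightarrow o')$; $\neg\rho\Rightarrow c'=c+\delta\wedge(\mathit{lefto}'\Leftrightarrow\mathit{lefto})$; $u\wedge\neg(r\wedge o)\Rightarrow\theta$. Here $\theta$ is $c+\delta<n\vee(\mathit{lefto}\wedge c+\delta\le n)$ for $F_{<n}$ and $c+\delta<n\vee((\neg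 o'\vee\mathit{lefto})\wedge c+\delta\le n)$ for $F_{\le n}$. * $\alpha U_{>n}\beta$, $\alpha U_{\ge n}\beta$, fresh Booleans $\mathit{oblig},\mathit{righto}$, clock $c$; with $\hat r:=r\wedge\theta$ and $\hat r'$ its next-state version: $u\Rightarrow\mathit{oblig}$; if $n>0$, $u\Rightarrow\mathit{oblig}'\wedge l'$; $\mathit{oblig}\wedge o\Rightarrow l\wedge(\hat r\vee\hat r'\vee(l'\wedge\mathit{oblig}'))$; $\mathit{oblig}\wedge\neg o\Rightarrow(\neg o'\wedge\hat r')\vee(l'\wedge\mathit{oblig}')$; $u\Rightarrow c'=0\wedge(\mathit{righto}'\Leftrightarrow o)$; $\neg u\Rightarrow c'=c+\delta\wedge(\mathit{righto}'\Leftrightarrow\mathit{righto})$. Here $\theta$ is $c+\delta>n\vee(\mathit{righto}\wedge c+\delta\ge n)$ for $U_{>n}$ and $c+\delta>n\vee((\mathit{righto}\vee\neg o)\wedge c+\delta\ge n)$ for $U_{\ge n}$. Fairness: $\neg\mathit{oblig}\vee r$. * $\alpha R^s\beta$, fresh Boolean $\mathit{oblig}$: $u\wedge o\Rightarrow\mathit{oblig}$;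 $u\wedge\neg o\Rightarrow\mathit{oblig}'$; $\mathit{oblig}\Rightarrow l\vee\mathit{oblig}'$; $\mathit{oblig}\Rightarrow(o\wedge l)\vee r$. * $G_{\le 0}\alpha$: $u\Rightarrow o\vee o'\vee(r'\wedge u')$. * $G_{<n}\alpha$, $G_{\le n}\alpha$ ($n>0$), fresh Boolean $\mathit{righto}$, clock $c$: $(u\wedge o)\vee\theta\Rightarrow r$; $u\Rightarrow c'=0\wedge(\mathit{righto}'\Leftrightarrow o)$; $\neg u\Rightarrow c'=c+\delta\wedge(\mathit{righto}'\Leftrightarrow\mathit{righto})$. Here $\theta$ is $c<n$ for $G_{<n}$ and $c<n\vee(c\le n\wedge\neg o\wedge\neg\mathit{righto})$ for $G_{\le n}$. * $\alpha R_{>n}\beta$, $\alpha R_{\ge n}\beta$, fresh Booleans $\mathit{oblig},\mathit{lefto}$, clock $c$, initially $c=0\wedge\neg\mathit{lefto}$; with $D:=\neg o\wedge\mathit{oblig}\wedge l\wedge u$ and $\rho:=u'\wedge(\neg\mathit{oblig}\vee l)\wedge(o\vee\neg u)$: $u\wedge o\Rightarrow\mathit{oblig}$; $u\wedge\neg o\Rightarrow\mathit{oblig}'$;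 $\mathit{oblig}\Rightarrow l\vee\mathit{oblig}'$; $\mathit{oblig}\wedge\theta\Rightarrow(l\wedge o)\vee r$; $u\wedge\delta>n\Rightarrow l\vee r$; $D\Rightarrow c'=0\wedge\neg\mathit{lefto}'$; $\rho\Rightarrow c'=0\wedge(\mathit{lefto}'\Leftrightarrow o')$; $\neg\rho\wedge\neg D\Rightarrow c'=c+\delta\wedge(\mathit{lefto}'\Leftrightarrow\mathit{lefto})$. Here $\theta$ is $c+\delta>n$ for $R_{>n}$ and $c+\delta>n\vee(\neg\mathit{lefto}\wedge\neg o\wedge c+\delta\ge n)$ for $R_{\ge n}$. **Lemma (soundness of the encodings).** For every transition system $\mathcal S$ over $AP$ and $p\in AP$, $\mathcal S_p$ is a sound encoding of $p$ for $\mathcal S$ and $\mathcal S_{\neg p}$ is a sound encoding of $\neg p$ for $\mathcal S$. Let $\mathcal S$ and $\mathcal S^0$ be transition systems over $AP$. If $\mathcal S$ is a sound encoding of $\alpha$ for $\mathcal S^0$, then $\mathcal S_{\mathrm{Op}\,\alpha}$ is a sound encoding of $\mathrm{Op}\,\alpha$ for $\mathcal S^0$, for each $\mathrm{Op}$ among $F_{\le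 0}$, $G_{\le 0}$, and $F_{<n},F_{\le n},G_{<n},G_{\le n}$ with $n>0$. If $\mathcal S$ is a sound encoding of $\alpha$ and of $\beta$ for $\mathcal S^0$, then $\mathcal S_{\alpha\,\mathrm{Op}\,\beta}$ is a sound encoding of $\alpha\,\mathrm{Op}\,\beta$ for $\mathcal S^0$, for each $\mathrm{Op}$ among $\wedge,\vee,U^s,R^s$ and $U_{\ge n},U_{>n},R_{\ge n},R_{>n}$ with $n\in\mathbb N$. -/

import Mathlib

open Filter

/-! ## The logic MITL with constraints `≤ n, < n, ≥ n, > n`, in positive normal form -/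

/-- The four comparisons `<`, `≤`, `≥`, `>` that occur in time constraints of formulas. -/
inductive Ineq where
  | lt | le | ge | gt

/-- `Ineq.holds r d n` is `d ⋈ n`. -/
def Ineq.holds : Ineq → ℝ → ℕ → Prop
  | .lt, d, n => d < n
  | .le, d, n => d ≤ n
  | .ge, d, n => d ≥ n
  | .gt, d, n => d > n

/-- Formulas over the set `AP` of atomic propositions, in positive normal form.
`until r n φ ψ` is the strict timed until `φ U_{⋈ n} ψ`, and `release r n φ ψ` the strict timed
release. `ev r n φ` is `F_{⋈ n} φ` and `alw r n φ` is `G_{⋈ n} φ`; they have constructors of their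
own because they are encoded as unary operators. -/
inductive MITL (AP : Type*) where
  | atom (p : AP)
  | negAtom (p : AP)
  | and (φ ψ : MITL AP)
  | or (φ ψ : MITL AP)
  | until (r : Ineq) (n : ℕ) (φ ψ : MITL AP)
  | release (r : Ineq) (n : ℕ) (φ ψ : MITL AP)
  | ev (r : Ineq) (n : ℕ) (φ : MITL AP)
  | alw (r : Ineq) (n : ℕ) (φ : MITL AP)

namespace MITL

variable {AP : Type*}

/-- The untimed strict until `φ Uˢ ψ`, i.e. `φ U_{≥ 0} ψ`. -/
abbrev suntil (φ ψ : MITL AP) : MITL AP := .until .ge 0 φ ψ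

/-- The untimed strict release `φ Rˢ ψ`, i.e. `φ R_{≥ 0} ψ`. -/
abbrev srelease (φ ψ : MITL AP) : MITL AP := .release .ge 0 φ ψ

/-- The sub-formulas of a formula in positive normal form, including the formula itself. -/
def subformulas : MITL AP → Set (MITL AP)
  | .atom p => {.atom p}
  | .negAtom p => {.negAtom p}
  | .and φ ψ => {.and φ ψ} ∪ φ.subformulas ∪ ψ.subformulas
  | .or φ ψ => {.or φ ψ} ∪ φ.subformulas ∪ ψ.subformulas
  | .until r n φ ψ => {.until r n φ ψ} ∪ φ.subformulas ∪ ψ.subformulas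
  | .release r n φ ψ => {.release r n φ ψ} ∪ φ.subformulas ∪ ψ.subformulas
  | .ev r n φ => {.ev r n φ} ∪ φ.subformulas
  | .alw r n φ => {.alw r n φ} ∪ φ.subformulas

end MITL

/-! ## Super-dense timed traces -/

/-- A singleton `[t, t]` or an open interval `(l, r)`. -/
inductive TInterval where
  | point (t : ℝ)
  | opn (l r : ℝ)

/-- The set of time points of an interval. -/
def TInterval.toSet : TInterval → Set ℝ
  | .point t => {t}
  | .opn l r => Set.Ioo l r

/-- Bounds are non-negative and open intervals are non-degenerate. -/
def TInterval.WF : TInterval → Prop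
  | .point t => 0 ≤ t
  | .opn l r => 0 ≤ l ∧ l < r

/-- A super-dense timed trace over `AP`. -/
@[ext]
structure SDTrace (AP : Type*) where
  /-- the intervals `I_i` -/
  itv : ℕ → TInterval
  /-- the sets `v_i` of atomic propositions -/
  label : ℕ → Set AP
  wf : ∀ i, (itv i).WF
  start : itv 0 = .point 0
  next_opn : ∀ i l r, itv i = .opn l r → itv (i + 1) = .point r
  next_point : ∀ i t, itv i = .point t →
    itv (i + 1) = .point t ∨ ∃ r, itv (i + 1) = .opn t r
  cover : ∀ t : ℝ, 0 ≤ t → ∃ i, t ∈ (itv i).toSet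

/-- The "earlier" relation `(i, t) ≺ (i', t')` on points. -/
def Earlier (i : ℕ) (t : ℝ) (i' : ℕ) (t' : ℝ) : Prop := i < i' ∨ (i = i' ∧ t < t')

namespace SDTrace

variable {AP : Type*} (σ : SDTrace AP)

/-- `(i', t')` is a point of `σ` that is later than `(i, t)`. -/
def Later (i : ℕ) (t : ℝ) (i' : ℕ) (t' : ℝ) : Prop :=
  t' ∈ (σ.itv i').toSet ∧ Earlier i t i' t'

/-- `σ.Sat φ i t` says that `σ` satisfies `φ` at the point `(i, t)`. The clauses for `ev` and `alw`
are those of `true U_{⋈ n} φ` and of `false R_{⋈ n} φ`. -/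
def Sat : MITL AP → ℕ → ℝ → Prop
  | .atom p, i, _ => p ∈ σ.label i
  | .negAtom p, i, _ => p ∉ σ.label i
  | .and φ ψ, i, t => Sat φ i t ∧ Sat ψ i t
  | .or φ ψ, i, t => Sat φ i t ∨ Sat ψ i t
  | .until r n φ ψ, i, t =>
      ∃ i' t', σ.Later i t i' t' ∧ r.holds (t' - t) n ∧ Sat ψ i' t' ∧
        ∀ i'' t'', σ.Later i t i'' t'' → Earlier i'' t'' i' t' → Sat φ i'' t''
  | .release r n φ ψ, i, t =>
      ∀ i' t', σ.Later i t i' t' → r.holds (t' - t) n ∧ ¬ Sat ψ i' t' →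
        ∃ i'' t'', σ.Later i t i'' t'' ∧ Earlier i'' t'' i' t' ∧ Sat φ i'' t''
  | .ev r n φ, i, t =>
      ∃ i' t', σ.Later i t i' t' ∧ r.holds (t' - t) n ∧ Sat φ i' t'
  | .alw r n φ, i, t =>
      ∀ i' t', σ.Later i t i' t' → r.holds (t' - t) n → Sat φ i' t'

end SDTrace

/-! ## Quantifier-free formulas over typed variables -/

/-- Boolean combinations of atoms. -/
inductive BForm (A : Type*) where
  | atom (a : A)
  | tru
  | neg (f : BForm A)
  | and (f g : BForm A)
  | or (f g : BForm A)
  | imp (f g : BForm A)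
  | iff (f g : BForm A)

prefix:max "¬ᵇ" => BForm.neg
infixr:35 " ∧ᵇ " => BForm.and
infixr:30 " ∨ᵇ " => BForm.or
infixr:25 " →ᵇ " => BForm.imp
infix:20 " ↔ᵇ " => BForm.iff

namespace BForm

variable {A A' : Type*}

/-- Truth value of a formula under an interpretation of its atoms. -/
def eval (v : A → Prop) : BForm A → Prop
  | .atom a => v a
  | .tru => True
  | .neg f => ¬ eval v f
  | .and f g => eval v f ∧ eval v g
  | .or f g => eval v f ∨ eval v g
  | .imp f g => eval v f → eval v g
  | .iff f g => (eval v f ↔ eval v g)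

/-- Renaming of atoms. -/
def map (h : A → A') : BForm A → BForm A'
  | .atom a => .atom (h a)
  | .tru => .tru
  | .neg f => .neg (map h f)
  | .and f g => .and (map h f) (map h g)
  | .or f g => .or (map h f) (map h g)
  | .imp f g => .imp (map h f) (map h g)
  | .iff f g => .iff (map h f) (map h g)

/-- Conjunction of a list of formulas. -/
def conj : List (BForm A) → BForm A
  | [] => .tru
  | f :: l => .and f (conj l)

theorem eval_map (h : A → A') (v : A' → Prop) (f : BForm A) :
    (f.map h).eval v ↔ f.eval (fun a => v (h a)) := by
  induction f <;> simp_all [map, eval]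

end BForm

/-- The comparisons `<`, `≤`, `=`, `≥`, `>` that occur in atoms on clocks and durations. -/
inductive Cmp where
  | lt | le | eq | ge | gt

/-- `Cmp.holds r d n` is `d ⋈ n`. -/
def Cmp.holds : Cmp → ℝ → ℕ → Prop
  | .lt, d, n => d < n
  | .le, d, n => d ≤ n
  | .eq, d, n => d = n
  | .ge, d, n => d ≥ n
  | .gt, d, n => d > n

/-- A finite set of typed variables: the non-clock variables are the Boolean variables `B` and the
variables `Z` with domains `Dom`, the clock variables are `X`. -/
structure Sig where
  B : Type
  Z : Type
  Dom : Z → Type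
  X : Type
  finite_B : Finite B
  finite_Z : Finite Z
  finite_X : Finite X

/-- Valuations of the non-clock variables. -/
structure NVal (V : Sig) where
  bool : V.B → Bool
  val : ∀ z : V.Z, V.Dom z

/-- Valuations of all variables. -/
structure State (V : Sig) extends NVal V where
  clk : V.X → ℝ

/-- Atoms over the non-clock variables: arbitrary predicates of the background theory. -/
def ZAtom (V : Sig) : Type := NVal V → Prop

/-- Atoms over current non-clock and clock variables. -/
inductive StAtom (V : Sig) where
  | nonclock (P : NVal V → Prop)
  /-- `x ⋈ n` -/
  | clock (x : V.X) (r : Cmp) (n : ℕ)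

/-- Atoms over current and next-state variables and durations. No atom mixes non-clock variables
with clocks or durations. -/
inductive TrAtom (V : Sig) where
  | nonclock (P : NVal V → NVal V → Prop)
  /-- `x' = 0` -/
  | reset (x : V.X)
  /-- `x' = x + δ` -/
  | advance (x : V.X)
  /-- `x ⋈ n` -/
  | clock (x : V.X) (r : Cmp) (n : ℕ)
  /-- `x + δ ⋈ n` -/
  | clockDur (x : V.X) (r : Cmp) (n : ℕ)
  /-- `δ ⋈ n` -/
  | dur (r : Cmp) (n : ℕ)
  /-- `x' + δ' ⋈ n` -/
  | clockDurNext (x : V.X) (r : Cmp) (n : ℕ)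
  /-- `δ' ⋈ n` -/
  | durNext (r : Cmp) (n : ℕ)

/-- `z ⊨ f` for a formula `f` over the non-clock variables. -/
def NVal.sat {V : Sig} (z : NVal V) (f : BForm (ZAtom V)) : Prop := f.eval (fun P => P z)

/-- Interpretation of an atom in a state. -/
def State.satAtom {V : Sig} (s : State V) : StAtom V → Prop
  | .nonclock P => P s.toNVal
  | .clock x r n => r.holds (s.clk x) n

/-- `s ⊨ f` for a formula `f` over the current variables. -/
def State.sat {V : Sig} (s : State V) (f : BForm (StAtom V)) : Prop := f.eval s.satAtom

/-- Interpretation of an atom at state `s` and duration `δ`, followed by state `s'` and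
duration `δ'`. -/
def stepSatAtom {V : Sig} (s : State V) (δ : ℝ) (s' : State V) (δ' : ℝ) : TrAtom V → Prop
  | .nonclock P => P s.toNVal s'.toNVal
  | .reset x => s'.clk x = 0
  | .advance x => s'.clk x = s.clk x + δ
  | .clock x r n => r.holds (s.clk x) n
  | .clockDur x r n => r.holds (s.clk x + δ) n
  | .dur r n => r.holds δ n
  | .clockDurNext x r n => r.holds (s'.clk x + δ') n
  | .durNext r n => r.holds δ' n

/-- Truth of a formula over current and next-state variables and durations. -/
def stepSat {V : Sig} (s : State V) (δ : ℝ) (s' : State V) (δ' : ℝ)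
    (f : BForm (TrAtom V)) : Prop :=
  f.eval (stepSatAtom s δ s' δ')

/-! ## Symbolic transition systems with clock-like variables -/

/-- A symbolic transition system with clock-like variables over `AP`. -/
structure TransSys (AP : Type*) where
  /-- the variables -/
  sig : Sig
  /-- the initial state formula -/
  init : BForm (StAtom sig)
  /-- the state invariant -/
  inv : BForm (StAtom sig)
  /-- the transition relation formula -/
  trans : BForm (TrAtom sig)
  /-- the finitely many fairness formulas -/
  fair : List (BForm (ZAtom sig))
  /-- the formula associated with an atomic proposition -/
  prop : AP → BForm (ZAtom sig)
  /-- durations are non-negative, and every clock is either reset or advanced by the duration -/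
  trans_clock : ∀ (s : State sig) (δ : ℝ) (s' : State sig) (δ' : ℝ),
    (∀ x, 0 ≤ s.clk x) → (∀ x, 0 ≤ s'.clk x) → stepSat s δ s' δ' trans →
      0 ≤ δ ∧ ∀ x, s'.clk x = 0 ∨ s'.clk x = s.clk x + δ

/-- A (non-zeno) run of a transition system. -/
structure Run {AP : Type*} (S : TransSys AP) where
  /-- the states `s_i` -/
  st : ℕ → State S.sig
  /-- the durations `δ_i` -/
  dur : ℕ → ℝ
  dur_zero : dur 0 = 0
  dur_nonneg : ∀ i, 0 ≤ dur i
  clk_nonneg : ∀ i x, 0 ≤ (st i).clk x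
  dur_alt : ∀ i, 0 < dur i → dur (i + 1) = 0
  init : (st 0).sat S.init
  inv : ∀ i, (st i).sat S.inv
  trans : ∀ i, stepSat (st i) (dur i) (st (i + 1)) (dur (i + 1)) S.trans
  fair : ∀ f ∈ S.fair, ∃ᶠ i in atTop, (st i).toNVal.sat f
  nonzeno : Tendsto (fun k => ∑ j ∈ Finset.range k, dur j) atTop atTop

namespace Run

variable {AP : Type*} {S : TransSys AP} (τ : Run S)

/-- The time `t_i = δ_0 + ... + δ_{i-1}` at which interval `i` starts. -/
def time (i : ℕ) : ℝ := ∑ j ∈ Finset.range i, τ.dur j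

open Classical in
/-- The interval represented by the `i`-th state of the run. -/
noncomputable def itv (i : ℕ) : TInterval :=
  if τ.dur i = 0 then .point (τ.time i) else .opn (τ.time i) (τ.time i + τ.dur i)

theorem time_succ (i : ℕ) : τ.time (i + 1) = τ.time i + τ.dur i :=
  Finset.sum_range_succ _ _

theorem time_nonneg (i : ℕ) : 0 ≤ τ.time i :=
  Finset.sum_nonneg fun _ _ => τ.dur_nonneg _

/-- The super-dense timed trace represented by a run. -/
noncomputable def trace : SDTrace AP where
  itv := τ.itv
  label i := {p | (τ.st i).toNVal.sat (S.prop p)}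
  wf i := by
    have h := τ.time_nonneg i
    have h' := τ.dur_nonneg i
    unfold itv
    split_ifs with h0
    · exact h
    · exact ⟨h, by have := lt_of_le_of_ne h' (Ne.symm h0); linarith⟩
  start := by simp [itv, τ.dur_zero, time]
  next_opn i l r h := by
    unfold itv at h
    split_ifs at h with h0
    have hp : 0 < τ.dur i := lt_of_le_of_ne (τ.dur_nonneg i) (Ne.symm h0)
    simp only [TInterval.opn.injEq] at h
    simp [itv, τ.dur_alt i hp, τ.time_succ, h.2]
  next_point i t h := by
    unfold itv at h
    split_ifs at h with h0
    simp only [TInterval.point.injEq] at h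
    unfold itv
    rw [τ.time_succ, h0, add_zero, h]
    split_ifs
    · exact Or.inl rfl
    · exact Or.inr ⟨_, rfl⟩
  cover t ht := by
    classical
    have hex : ∃ k, t < τ.time (k + 1) := by
      obtain ⟨k, hk⟩ := ((tendsto_add_atTop_iff_nat 1).2 τ.nonzeno).eventually_gt_atTop t |>.exists
      exact ⟨k, hk⟩
    have hk := Nat.find_spec hex
    have hmin := fun m => Nat.find_min (H := hex) (m := m)
    generalize Nat.find hex = k at hk hmin
    rw [τ.time_succ] at hk
    have hle : τ.time k ≤ t := by
      cases k with
      | zero => simpa [time] using ht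
      | succ m => exact not_lt.1 (hmin m (Nat.lt_succ_self m))
    rcases hle.lt_or_eq with hlt | heq
    · refine ⟨k, ?_⟩
      have : τ.dur k ≠ 0 := by intro h; linarith
      simp [itv, this, TInterval.toSet, hlt, hk]
    · have hd : 0 < τ.dur k := by linarith
      cases k with
      | zero => exact absurd τ.dur_zero hd.ne'
      | succ m =>
        have hm : τ.dur m = 0 := by
          by_contra hne
          exact hd.ne' (τ.dur_alt m (lt_of_le_of_ne (τ.dur_nonneg m) (Ne.symm hne)))
        refine ⟨m, ?_⟩
        rw [τ.time_succ, hm, add_zero] at heq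
        simp [itv, hm, TInterval.toSet, heq]

end Run

/-- The set of traces of a transition system. -/
def TransSys.traces {AP : Type*} (S : TransSys AP) : Set (SDTrace AP) :=
  Set.range (Run.trace (S := S))

/-! ## Extending a transition system by fresh variables and constraints -/

/-- Adjoin `w` fresh Boolean variables and `y` fresh clock variables. -/
abbrev Sig.extend (V : Sig) (w y : ℕ) : Sig where
  B := V.B ⊕ Fin w
  Z := V.Z
  Dom := V.Dom
  X := V.X ⊕ Fin y
  finite_B := by have := V.finite_B; infer_instance
  finite_Z := V.finite_Z
  finite_X := by have := V.finite_X; infer_instance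

section Lifting

variable {V : Sig} {w y : ℕ}

/-- Restriction of a valuation to the old variables. -/
def NVal.restrict (z : NVal (V.extend w y)) : NVal V where
  bool b := z.bool (Sum.inl b)
  val := z.val

/-- Restriction of a state to the old variables. -/
def State.restrict (s : State (V.extend w y)) : State V where
  toNVal := s.toNVal.restrict
  clk x := s.clk (Sum.inl x)

/-- Atoms over the old variables, read over the extended ones. -/
def ZAtom.lift (P : ZAtom V) : ZAtom (V.extend w y) := fun z => P z.restrict

/-- Atoms over the old variables, read over the extended ones. -/
def StAtom.lift : StAtom V → StAtom (V.extend w y)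
  | .nonclock P => .nonclock fun z => P z.restrict
  | .clock x r n => .clock (Sum.inl x) r n

/-- Atoms over the old variables, read over the extended ones. -/
def TrAtom.lift : TrAtom V → TrAtom (V.extend w y)
  | .nonclock P => .nonclock fun z z' => P z.restrict z'.restrict
  | .reset x => .reset (Sum.inl x)
  | .advance x => .advance (Sum.inl x)
  | .clock x r n => .clock (Sum.inl x) r n
  | .clockDur x r n => .clockDur (Sum.inl x) r n
  | .dur r n => .dur r n
  | .clockDurNext x r n => .clockDurNext (Sum.inl x) r n
  | .durNext r n => .durNext r n

theorem stepSat_lift (s : State (V.extend w y)) (δ : ℝ) (s' : State (V.extend w y)) (δ' : ℝ)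
    (f : BForm (TrAtom V)) :
    stepSat s δ s' δ' (f.map TrAtom.lift) ↔ stepSat s.restrict δ s'.restrict δ' f := by
  unfold stepSat
  rw [BForm.eval_map]
  have : (fun a => stepSatAtom s δ s' δ' (TrAtom.lift a)) =
      stepSatAtom s.restrict δ s'.restrict δ' := by
    funext a
    cases a <;> rfl
  rw [this]

end Lifting

/-- `⟨Z ∪ Z_φ, X ∪ X_φ, I ∧ I_φ, INV, T ∧ T_φ, F ∪ F_φ, AP^⟩`, with `w` Boolean variables in `Z_φ`
and `y` clocks in `X_φ`. -/
abbrev TransSys.extend {AP : Type*} (S : TransSys AP) (w y : ℕ)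
    (I : BForm (StAtom (S.sig.extend w y))) (T : BForm (TrAtom (S.sig.extend w y)))
    (F : List (BForm (ZAtom (S.sig.extend w y))))
    (hT : ∀ s δ s' δ', stepSat s δ s' δ' T → ∀ c : Fin y,
      s'.clk (Sum.inr c) = 0 ∨ s'.clk (Sum.inr c) = s.clk (Sum.inr c) + δ) : TransSys AP where
  sig := S.sig.extend w y
  init := S.init.map StAtom.lift ∧ᵇ I
  inv := S.inv.map StAtom.lift
  trans := S.trans.map TrAtom.lift ∧ᵇ T
  fair := S.fair.map (BForm.map ZAtom.lift) ++ F
  prop p := (S.prop p).map ZAtom.lift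
  trans_clock s δ s' δ' h h' ht := by
    have h1 := S.trans_clock s.restrict δ s'.restrict δ' (fun x => h _) (fun x => h' _)
      ((stepSat_lift s δ s' δ' _).1 ht.1)
    refine ⟨h1.1, fun x => ?_⟩
    rcases x with x | c
    · exact h1.2 x
    · exact hT s δ s' δ' ht.2 c

/-- A transition system some of whose Boolean variables are the designated variables `[ψ]` of
formulas `ψ`. -/
structure EncSys (AP : Type*) extends TransSys AP where
  enc : MITL AP → Option sig.B

/-- `E` is a sound encoding of `φ` for the system `S`: it has a variable `[ψ]` for each sub-formula
`ψ` of `φ`, it has the same traces as `S`, and `φ` holds at every point of the `i`-th interval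
whenever `[φ]` is true in the `i`-th state of a run. -/
def SoundEncoding {AP : Type*} (S : TransSys AP) (E : EncSys AP) (φ : MITL AP) : Prop :=
  (∀ ψ ∈ φ.subformulas, ∃ b, E.enc ψ = some b) ∧
  E.traces = S.traces ∧
  ∀ (τ : Run E.toTransSys) (i : ℕ) (b : E.sig.B), E.enc φ = some b → (τ.st i).bool b = true →
    ∀ t ∈ (τ.trace.itv i).toSet, τ.trace.Sat φ i t

open Classical in
/-- Extension by `w + 1` fresh Boolean variables, the first of which is `[φ]`, and `y` clocks. -/
noncomputable abbrev EncSys.extend {AP : Type*} (E : EncSys AP) (φ : MITL AP) (w y : ℕ)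
    (I : BForm (StAtom (E.sig.extend (w + 1) y))) (T : BForm (TrAtom (E.sig.extend (w + 1) y)))
    (F : List (BForm (ZAtom (E.sig.extend (w + 1) y))))
    (hT : ∀ s δ s' δ', stepSat s δ s' δ' T → ∀ c : Fin y,
      s'.clk (Sum.inr c) = 0 ∨ s'.clk (Sum.inr c) = s.clk (Sum.inr c) + δ) : EncSys AP where
  toTransSys := E.toTransSys.extend (w + 1) y I T F hT
  enc ψ := if ψ = φ then some (Sum.inr 0) else (E.enc ψ).map Sum.inl

/-! ## The constraints of the encodings

`out` is the variable `[φ]` of the encoded formula, `l` and `r` are the variables of its left and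
right operands (`r` alone for unary operators); `cur v` and `nxt v` are `v` and `v'`, and `opn`
and `opnN` are `open` and `open'`, where `open` stands for `δ > 0`. -/

namespace Enc

variable {V : Sig}

/-- `v` as an atom over the non-clock variables. -/
def var (v : V.B) : BForm (ZAtom V) := .atom fun z => z.bool v = true
/-- `v` -/
def cur (v : V.B) : BForm (TrAtom V) := .atom (.nonclock fun z _ => z.bool v = true)
/-- `v'` -/
def nxt (v : V.B) : BForm (TrAtom V) := .atom (.nonclock fun _ z' => z'.bool v = true)
/-- `open` -/
def opn : BForm (TrAtom V) := .atom (.dur .gt 0)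
/-- `open'` -/
def opnN : BForm (TrAtom V) := .atom (.durNext .gt 0)
/-- `c' = 0` -/
def reset (c : V.X) : BForm (TrAtom V) := .atom (.reset c)
/-- `c' = c + δ` -/
def adv (c : V.X) : BForm (TrAtom V) := .atom (.advance c)
/-- `c + δ ⋈ n` -/
def cd (c : V.X) (k : Cmp) (n : ℕ) : BForm (TrAtom V) := .atom (.clockDur c k n)
/-- `c' + δ' ⋈ n` -/
def cdN (c : V.X) (k : Cmp) (n : ℕ) : BForm (TrAtom V) := .atom (.clockDurNext c k n)
/-- a formula over the current non-clock variables, as part of a transition formula -/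
def here (f : BForm (ZAtom V)) : BForm (TrAtom V) := f.map fun P => .nonclock fun z _ => P z
/-- `c = 0 ∧ ¬ v` as an initial state formula -/
def initClock (c : V.X) (v : V.B) : BForm (StAtom V) :=
  .atom (.clock c .eq 0) ∧ᵇ ¬ᵇ(.atom (.nonclock fun z => z.bool v = true))

/-- Constraints for `l Uˢ r`. -/
def untilC (out l r : V.B) : BForm (TrAtom V) := .conj [
  cur out ∧ᵇ opn →ᵇ cur l ∧ᵇ (cur r ∨ᵇ nxt r ∨ᵇ (nxt l ∧ᵇ nxt out)),
  cur out ∧ᵇ ¬ᵇopn →ᵇ (¬ᵇopnN ∧ᵇ nxt r) ∨ᵇ (nxt l ∧ᵇ nxt out)]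

/-- Constraint for `F_{≤ 0} r`. -/
def evZeroC (out r : V.B) : BForm (TrAtom V) :=
  cur out →ᵇ ¬ᵇopn ∧ᵇ ¬ᵇopnN ∧ᵇ (nxt r ∨ᵇ nxt out)

/-- The shorthand deciding when `c` is reset in the encoding of `F_{< n} r` and `F_{≤ n} r`. -/
def evReset (out r : V.B) : BForm (TrAtom V) :=
  (¬ᵇ(cur out) ∨ᵇ (opn ∧ᵇ cur r) ∨ᵇ nxt r) ∧ᵇ nxt out

/-- Timing shorthand for `F_{< n} r`. -/
def evLtTime (lefto : V.B) (c : V.X) (n : ℕ) : BForm (TrAtom V) :=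
  cd c .lt n ∨ᵇ (cur lefto ∧ᵇ cd c .le n)

/-- Timing shorthand for `F_{≤ n} r`. -/
def evLeTime (lefto : V.B) (c : V.X) (n : ℕ) : BForm (TrAtom V) :=
  cd c .lt n ∨ᵇ ((¬ᵇopnN ∨ᵇ cur lefto) ∧ᵇ cd c .le n)

/-- Constraints for `F_{< n} r` and `F_{≤ n} r`, with timing shorthand `TC`. -/
def evC (out lefto r : V.B) (c : V.X) (TC : BForm (TrAtom V)) : BForm (TrAtom V) := .conj [
  cur out ∧ᵇ opn →ᵇ cur r ∨ᵇ nxt r ∨ᵇ nxt out,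
  cur out ∧ᵇ ¬ᵇopn →ᵇ nxt r ∨ᵇ nxt out,
  evReset out r →ᵇ reset c ∧ᵇ (nxt lefto ↔ᵇ opnN),
  ¬ᵇ(evReset out r) →ᵇ adv c ∧ᵇ (nxt lefto ↔ᵇ cur lefto),
  cur out ∧ᵇ ¬ᵇ(cur r ∧ᵇ opn) →ᵇ TC]

/-- Timing shorthand for `l U_{> n} r`. -/
def untilGtTime (righto : V.B) (c : V.X) (n : ℕ) : BForm (TrAtom V) :=
  cd c .gt n ∨ᵇ (cur righto ∧ᵇ cd c .ge n)

/-- Next-state version of `untilGtTime`. -/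
def untilGtTimeN (righto : V.B) (c : V.X) (n : ℕ) : BForm (TrAtom V) :=
  cdN c .gt n ∨ᵇ (nxt righto ∧ᵇ cdN c .ge n)

/-- Timing shorthand for `l U_{≥ n} r`. -/
def untilGeTime (righto : V.B) (c : V.X) (n : ℕ) : BForm (TrAtom V) :=
  cd c .gt n ∨ᵇ ((cur righto ∨ᵇ ¬ᵇopn) ∧ᵇ cd c .ge n)

/-- Next-state version of `untilGeTime`. -/
def untilGeTimeN (righto : V.B) (c : V.X) (n : ℕ) : BForm (TrAtom V) :=
  cdN c .gt n ∨ᵇ ((nxt righto ∨ᵇ ¬ᵇopnN) ∧ᵇ cdN c .ge n)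

/-- Constraints for `l U_{> n} r` and `l U_{≥ n} r`, with timing shorthand `TC` and its next-state
version `TCN`. -/
def untilLowC (out oblig righto l r : V.B) (c : V.X) (n : ℕ) (TC TCN : BForm (TrAtom V)) :
    BForm (TrAtom V) := .conj [
  cur out →ᵇ cur oblig,
  if 0 < n then cur out →ᵇ nxt oblig ∧ᵇ nxt l else .tru,
  cur oblig ∧ᵇ opn →ᵇ
    cur l ∧ᵇ ((cur r ∧ᵇ TC) ∨ᵇ (nxt r ∧ᵇ TCN) ∨ᵇ (nxt l ∧ᵇ nxt oblig)),
  cur oblig ∧ᵇ ¬ᵇopn →ᵇ (¬ᵇopnN ∧ᵇ nxt r ∧ᵇ TCN) ∨ᵇ (nxt l ∧ᵇ nxt oblig),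
  cur out →ᵇ reset c ∧ᵇ (nxt righto ↔ᵇ opn),
  ¬ᵇ(cur out) →ᵇ adv c ∧ᵇ (nxt righto ↔ᵇ cur righto)]

/-- Constraints for `l Rˢ r`. -/
def releaseC (out oblig l r : V.B) : BForm (TrAtom V) := .conj [
  cur out ∧ᵇ opn →ᵇ cur oblig,
  cur out ∧ᵇ ¬ᵇopn →ᵇ nxt oblig,
  cur oblig →ᵇ cur l ∨ᵇ nxt oblig,
  cur oblig →ᵇ (opn ∧ᵇ cur l) ∨ᵇ cur r]

/-- Constraint for `G_{≤ 0} r`. -/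
def alwZeroC (out r : V.B) : BForm (TrAtom V) :=
  cur out →ᵇ opn ∨ᵇ opnN ∨ᵇ (nxt r ∧ᵇ nxt out)

/-- Timing shorthand for `G_{< n} r`. -/
def alwLtTime (c : V.X) (n : ℕ) : BForm (TrAtom V) := .atom (.clock c .lt n)

/-- Timing shorthand for `G_{≤ n} r`. -/
def alwLeTime (righto : V.B) (c : V.X) (n : ℕ) : BForm (TrAtom V) :=
  .atom (.clock c .lt n) ∨ᵇ (.atom (.clock c .le n) ∧ᵇ ¬ᵇopn ∧ᵇ ¬ᵇ(cur righto))

/-- Constraints for `G_{< n} r` and `G_{≤ n} r`, with timing shorthand `TC`. -/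
def alwC (out righto r : V.B) (c : V.X) (TC : BForm (TrAtom V)) : BForm (TrAtom V) := .conj [
  (cur out ∧ᵇ opn) ∨ᵇ TC →ᵇ cur r,
  cur out →ᵇ reset c ∧ᵇ (nxt righto ↔ᵇ opn),
  ¬ᵇ(cur out) →ᵇ adv c ∧ᵇ (nxt righto ↔ᵇ cur righto)]

/-- The shorthand deciding when the reset of `c` is delayed in the encoding of `l R_{> n} r` and
`l R_{≥ n} r`. -/
def releaseDelay (out oblig l : V.B) : BForm (TrAtom V) :=
  ¬ᵇopn ∧ᵇ cur oblig ∧ᵇ cur l ∧ᵇ cur out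

/-- The shorthand deciding when `c` is reset in the encoding of `l R_{> n} r` and `l R_{≥ n} r`. -/
def releaseReset (out oblig l : V.B) : BForm (TrAtom V) :=
  nxt out ∧ᵇ (¬ᵇ(cur oblig) ∨ᵇ cur l) ∧ᵇ (opn ∨ᵇ ¬ᵇ(cur out))

/-- Timing shorthand for `l R_{> n} r`. -/
def releaseGtTime (c : V.X) (n : ℕ) : BForm (TrAtom V) := cd c .gt n

/-- Timing shorthand for `l R_{≥ n} r`. -/
def releaseGeTime (lefto : V.B) (c : V.X) (n : ℕ) : BForm (TrAtom V) :=
  cd c .gt n ∨ᵇ (¬ᵇ(cur lefto) ∧ᵇ ¬ᵇopn ∧ᵇ cd c .ge n)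

/-- Constraints for `l R_{> n} r` and `l R_{≥ n} r`, with timing shorthand `TC`. -/
def releaseLowC (out oblig lefto l r : V.B) (c : V.X) (n : ℕ) (TC : BForm (TrAtom V)) :
    BForm (TrAtom V) := .conj [
  cur out ∧ᵇ opn →ᵇ cur oblig,
  cur out ∧ᵇ ¬ᵇopn →ᵇ nxt oblig,
  cur oblig →ᵇ cur l ∨ᵇ nxt oblig,
  cur oblig ∧ᵇ TC →ᵇ (cur l ∧ᵇ opn) ∨ᵇ cur r,
  cur out ∧ᵇ .atom (.dur .gt n) →ᵇ cur l ∨ᵇ cur r,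
  releaseDelay out oblig l →ᵇ reset c ∧ᵇ ¬ᵇ(nxt lefto),
  releaseReset out oblig l →ᵇ reset c ∧ᵇ (nxt lefto ↔ᵇ opnN),
  ¬ᵇ(releaseReset out oblig l) ∧ᵇ ¬ᵇ(releaseDelay out oblig l) →ᵇ
    adv c ∧ᵇ (nxt lefto ↔ᵇ cur lefto)]

variable {s : State V} {δ : ℝ} {s' : State V} {δ' : ℝ}

theorem evC_clock {out lefto r : V.B} {c : V.X} {TC : BForm (TrAtom V)}
    (h : stepSat s δ s' δ' (evC out lefto r c TC)) :
    s'.clk c = 0 ∨ s'.clk c = s.clk c + δ := by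
  obtain ⟨-, -, h1, h2, -⟩ := h
  by_cases hc : stepSat s δ s' δ' (evReset out r)
  · exact Or.inl (h1 hc).1
  · exact Or.inr (h2 hc).1

theorem untilLowC_clock {out oblig righto l r : V.B} {c : V.X} {n : ℕ}
    {TC TCN : BForm (TrAtom V)}
    (h : stepSat s δ s' δ' (untilLowC out oblig righto l r c n TC TCN)) :
    s'.clk c = 0 ∨ s'.clk c = s.clk c + δ := by
  obtain ⟨-, -, -, -, h1, h2, -⟩ := h
  by_cases hc : stepSat s δ s' δ' (cur out)
  · exact Or.inl (h1 hc).1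
  · exact Or.inr (h2 hc).1

theorem alwC_clock {out righto r : V.B} {c : V.X} {TC : BForm (TrAtom V)}
    (h : stepSat s δ s' δ' (alwC out righto r c TC)) :
    s'.clk c = 0 ∨ s'.clk c = s.clk c + δ := by
  obtain ⟨-, h1, h2, -⟩ := h
  by_cases hc : stepSat s δ s' δ' (cur out)
  · exact Or.inl (h1 hc).1
  · exact Or.inr (h2 hc).1

theorem releaseLowC_clock {out oblig lefto l r : V.B} {c : V.X} {n : ℕ}
    {TC : BForm (TrAtom V)}
    (h : stepSat s δ s' δ' (releaseLowC out oblig lefto l r c n TC)) :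
    s'.clk c = 0 ∨ s'.clk c = s.clk c + δ := by
  obtain ⟨-, -, -, -, -, h1, h2, h3, -⟩ := h
  by_cases hd : stepSat s δ s' δ' (releaseDelay out oblig l)
  · exact Or.inl (h1 hd).1
  by_cases hr : stepSat s δ s' δ' (releaseReset out oblig l)
  · exact Or.inl (h2 hr).1
  · exact Or.inr (h3 ⟨hr, hd⟩).1

end Enc

/-! ## The encoding of each operator

In each case the old variables `a` and `b` are `[α]` and `[β]`. -/

namespace EncSys

open Enc

variable {AP : Type*} (E : EncSys AP)

/-- The system encoding `p`. -/
noncomputable def encAtom (p : AP) : EncSys AP :=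
  E.extend (.atom p) 0 0 .tru
    (cur (.inr 0) ↔ᵇ here ((E.prop p).map ZAtom.lift))
    [] (fun _ _ _ _ _ c => c.elim0)

/-- The system encoding `¬ p`. -/
noncomputable def encNegAtom (p : AP) : EncSys AP :=
  E.extend (.negAtom p) 0 0 .tru
    (cur (.inr 0) ↔ᵇ ¬ᵇ(here ((E.prop p).map ZAtom.lift)))
    [] (fun _ _ _ _ _ c => c.elim0)

/-- The system encoding `α ∧ β`. -/
noncomputable def encAnd (α β : MITL AP) (a b : E.sig.B) : EncSys AP :=
  E.extend (.and α β) 0 0 .tru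
    (cur (.inr 0) ↔ᵇ cur (.inl a) ∧ᵇ cur (.inl b))
    [] (fun _ _ _ _ _ c => c.elim0)

/-- The system encoding `α ∨ β`. -/
noncomputable def encOr (α β : MITL AP) (a b : E.sig.B) : EncSys AP :=
  E.extend (.or α β) 0 0 .tru
    (cur (.inr 0) ↔ᵇ cur (.inl a) ∨ᵇ cur (.inl b))
    [] (fun _ _ _ _ _ c => c.elim0)

/-- The system encoding `α Uˢ β`. -/
noncomputable def encSUntil (α β : MITL AP) (a b : E.sig.B) : EncSys AP :=
  E.extend (.suntil α β) 0 0 .tru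
    (untilC (.inr 0) (.inl a) (.inl b))
    [¬ᵇ(var (.inr 0)) ∨ᵇ var (.inl b)] (fun _ _ _ _ _ c => c.elim0)

/-- The system encoding `F_{≤ 0} α`. -/
noncomputable def encEvZero (α : MITL AP) (a : E.sig.B) : EncSys AP :=
  E.extend (.ev .le 0 α) 0 0 .tru
    (evZeroC (.inr 0) (.inl a))
    [] (fun _ _ _ _ _ c => c.elim0)

/-- The system encoding `F_{< n} α` for `n > 0`; the fresh variables are `[F_{< n} α]`, `lefto` and
the clock `c`. -/
noncomputable def encEvLt (n : ℕ) (α : MITL AP) (a : E.sig.B) : EncSys AP :=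
  E.extend (.ev .lt n α) 1 1
    (initClock (.inr 0) (.inr 1))
    (evC (.inr 0) (.inr 1) (.inl a) (.inr 0) (evLtTime (.inr 1) (.inr 0) n))
    [] (fun _ _ _ _ h c => by rw [Fin.fin_one_eq_zero c]; exact evC_clock h)

/-- The system encoding `F_{≤ n} α` for `n > 0`; the fresh variables are `[F_{≤ n} α]`, `lefto` and
the clock `c`. -/
noncomputable def encEvLe (n : ℕ) (α : MITL AP) (a : E.sig.B) : EncSys AP :=
  E.extend (.ev .le n α) 1 1
    (initClock (.inr 0) (.inr 1))
    (evC (.inr 0) (.inr 1) (.inl a) (.inr 0) (evLeTime (.inr 1) (.inr 0) n))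
    [] (fun _ _ _ _ h c => by rw [Fin.fin_one_eq_zero c]; exact evC_clock h)

/-- The system encoding `α U_{> n} β`; the fresh variables are `[α U_{> n} β]`, `oblig`, `righto`
and the clock `c`. -/
noncomputable def encUntilGt (n : ℕ) (α β : MITL AP) (a b : E.sig.B) : EncSys AP :=
  E.extend (.until .gt n α β) 2 1 .tru
    (untilLowC (.inr 0) (.inr 1) (.inr 2) (.inl a) (.inl b) (.inr 0) n
      (untilGtTime (.inr 2) (.inr 0) n) (untilGtTimeN (.inr 2) (.inr 0) n))
    [¬ᵇ(var (.inr 1)) ∨ᵇ var (.inl b)]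
    (fun _ _ _ _ h c => by rw [Fin.fin_one_eq_zero c]; exact untilLowC_clock h)

/-- The system encoding `α U_{≥ n} β`; the fresh variables are `[α U_{≥ n} β]`, `oblig`, `righto`
and the clock `c`. -/
noncomputable def encUntilGe (n : ℕ) (α β : MITL AP) (a b : E.sig.B) : EncSys AP :=
  E.extend (.until .ge n α β) 2 1 .tru
    (untilLowC (.inr 0) (.inr 1) (.inr 2) (.inl a) (.inl b) (.inr 0) n
      (untilGeTime (.inr 2) (.inr 0) n) (untilGeTimeN (.inr 2) (.inr 0) n))
    [¬ᵇ(var (.inr 1)) ∨ᵇ var (.inl b)]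
    (fun _ _ _ _ h c => by rw [Fin.fin_one_eq_zero c]; exact untilLowC_clock h)

/-- The system encoding `α Rˢ β`; the fresh variables are `[α Rˢ β]` and `oblig`. -/
noncomputable def encSRelease (α β : MITL AP) (a b : E.sig.B) : EncSys AP :=
  E.extend (.srelease α β) 1 0 .tru
    (releaseC (.inr 0) (.inr 1) (.inl a) (.inl b))
    [] (fun _ _ _ _ _ c => c.elim0)

/-- The system encoding `G_{≤ 0} α`. -/
noncomputable def encAlwZero (α : MITL AP) (a : E.sig.B) : EncSys AP :=
  E.extend (.alw .le 0 α) 0 0 .tru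
    (alwZeroC (.inr 0) (.inl a))
    [] (fun _ _ _ _ _ c => c.elim0)

/-- The system encoding `G_{< n} α` for `n > 0`; the fresh variables are `[G_{< n} α]`, `righto` and
the clock `c`. -/
noncomputable def encAlwLt (n : ℕ) (α : MITL AP) (a : E.sig.B) : EncSys AP :=
  E.extend (.alw .lt n α) 1 1 .tru
    (alwC (.inr 0) (.inr 1) (.inl a) (.inr 0) (alwLtTime (.inr 0) n))
    [] (fun _ _ _ _ h c => by rw [Fin.fin_one_eq_zero c]; exact alwC_clock h)

/-- The system encoding `G_{≤ n} α` for `n > 0`; the fresh variables are `[G_{≤ n} α]`, `righto` and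
the clock `c`. -/
noncomputable def encAlwLe (n : ℕ) (α : MITL AP) (a : E.sig.B) : EncSys AP :=
  E.extend (.alw .le n α) 1 1 .tru
    (alwC (.inr 0) (.inr 1) (.inl a) (.inr 0) (alwLeTime (.inr 1) (.inr 0) n))
    [] (fun _ _ _ _ h c => by rw [Fin.fin_one_eq_zero c]; exact alwC_clock h)

/-- The system encoding `α R_{> n} β`; the fresh variables are `[α R_{> n} β]`, `oblig`, `lefto` and
the clock `c`. -/
noncomputable def encReleaseGt (n : ℕ) (α β : MITL AP) (a b : E.sig.B) : EncSys AP :=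
  E.extend (.release .gt n α β) 2 1
    (initClock (.inr 0) (.inr 2))
    (releaseLowC (.inr 0) (.inr 1) (.inr 2) (.inl a) (.inl b) (.inr 0) n
      (releaseGtTime (.inr 0) n))
    [] (fun _ _ _ _ h c => by rw [Fin.fin_one_eq_zero c]; exact releaseLowC_clock h)

/-- The system encoding `α R_{≥ n} β`; the fresh variables are `[α R_{≥ n} β]`, `oblig`, `lefto` and
the clock `c`. -/
noncomputable def encReleaseGe (n : ℕ) (α β : MITL AP) (a b : E.sig.B) : EncSys AP :=
  E.extend (.release .ge n α β) 2 1
    (initClock (.inr 0) (.inr 2))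
    (releaseLowC (.inr 0) (.inr 1) (.inr 2) (.inl a) (.inl b) (.inr 0) n
      (releaseGeTime (.inr 2) (.inr 0) n))
    [] (fun _ _ _ _ h c => by rw [Fin.fin_one_eq_zero c]; exact releaseLowC_clock h)

end EncSys

/-! ## Points of the trace of a run -/

/-! For each operator two things matter: the added constraints remove no trace, and a true `[φ]`
forces φ at every point of its interval.

Traces: restricting a run to the old variables keeps its trace, so only values of the fresh
variables along an arbitrary old run are needed (`traces_extend`). Encodings only have to be sound,
so `[φ]` may always be false: for temporal operators it suffices to make all fresh Booleans false
and never reset the clocks, with a large enough initial value for G (`traces_extend_false`). For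
literals, ∧ and ∨ the value of `[φ]` is forced by an equivalence.

Soundness: truth depends on the trace alone, so the operands' variables stay sound in the extension
(`SoundEncoding.approx`). What remains concerns sequences of truth values and reals along one run.
Untimed arguments follow an obligation from interval to interval. For U it is either discharged or
passed on forever, and then fairness and non-zenoness supply a late witness (`until_chain`,
`sat_until_of_forever`). For R it survives until an interval with `l`, which provides the releasing
point (`release_chain`).

The clocks bound the time elapsed since a point where `[φ]` held, each in the safe direction. For U
and G the clock restarts whenever `[φ]` holds, so it never exceeds the elapsed time
(`clock_le_of_reset`): U then waits long enough and G demands its operand long enough. For F and R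
it keeps running while an obligation is pending, so it is at least the elapsed time (`sat_ev`,
`sat_releaseLow`): F meets its deadline and R starts its demands in time. The flags `righto` and
`lefto` decide borderline equalities, since open intervals do not attain their end points. -/

namespace Run

variable {AP : Type*} {S : TransSys AP} (τ : Run S)

/-- `t` lies in the `i`-th interval of the trace of `τ`. -/
def At (i : ℕ) (t : ℝ) : Prop := t ∈ (τ.trace.itv i).toSet

/-- This turns interval membership into inequalities between start times; the point estimates below
all rest on it. -/
theorem at_iff {i : ℕ} {t : ℝ} : τ.At i t ↔
    (τ.dur i = 0 ∧ t = τ.time i) ∨ (0 < τ.dur i ∧ τ.time i < t ∧ t < τ.time (i + 1)) := by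
  rw [time_succ]
  by_cases h : τ.dur i = 0
  · simp [At, trace, itv, h, TInterval.toSet]
  · simp [At, trace, itv, h, TInterval.toSet, lt_of_le_of_ne (τ.dur_nonneg i) (Ne.symm h)]

theorem dur_eq_zero {i : ℕ} (h : ¬ 0 < τ.dur i) : τ.dur i = 0 :=
  le_antisymm (not_lt.1 h) (τ.dur_nonneg i)

theorem not_opn_succ {i : ℕ} (h : 0 < τ.dur i) : ¬ 0 < τ.dur (i + 1) := by
  simp [τ.dur_alt i h]

theorem time_mono : Monotone τ.time :=
  monotone_nat_of_le_succ fun i => by rw [time_succ]; linarith [τ.dur_nonneg i]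

theorem time_lt_succ {i : ℕ} (h : 0 < τ.dur i) : τ.time i < τ.time (i + 1) := by
  rw [time_succ]; linarith

/-- Non-zenoness in the form that refutes obligations postponed forever within bounded time. -/
theorem exists_time_gt (a : ℝ) (m : ℕ) : ∃ k ≥ m, a < τ.time k := by
  obtain ⟨k, h, hk⟩ :=
    ((eventually_ge_atTop m).and (τ.nonzeno.eventually_gt_atTop a)).exists
  exact ⟨k, h, hk⟩

variable {τ}

theorem At.time_le {i : ℕ} {t : ℝ} (h : τ.At i t) : τ.time i ≤ t := by
  rcases τ.at_iff.1 h with h | h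
  · exact h.2.ge
  · exact h.2.1.le

theorem At.le_time {i k : ℕ} {t : ℝ} (h : τ.At i t) (hk : i < k) : t ≤ τ.time k := by
  have h1 : τ.time (i + 1) ≤ τ.time k := τ.time_mono hk
  rcases τ.at_iff.1 h with h | h
  · rw [time_succ, h.1] at h1
    linarith [h.2]
  · linarith [h.2.2]

theorem At.time_lt {i : ℕ} {t : ℝ} (h : τ.At i t) (ho : 0 < τ.dur i) : τ.time i < t := by
  rcases τ.at_iff.1 h with h | h
  · exact absurd h.1 ho.ne'
  · exact h.2.1

theorem At.lt_time {i k : ℕ} {t : ℝ} (h : τ.At i t) (ho : 0 < τ.dur i) (hk : i < k) :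
    t < τ.time k := by
  have h1 : τ.time (i + 1) ≤ τ.time k := τ.time_mono hk
  rcases τ.at_iff.1 h with h | h
  · exact absurd h.1 ho.ne'
  · linarith [h.2.2]

theorem At.eq_time {i : ℕ} {t : ℝ} (h : τ.At i t) (ho : ¬ 0 < τ.dur i) : t = τ.time i := by
  rcases τ.at_iff.1 h with h | h
  · exact h.2
  · exact absurd h.1 ho

variable (τ)

theorem at_time {i : ℕ} (ho : ¬ 0 < τ.dur i) : τ.At i (τ.time i) :=
  τ.at_iff.2 (Or.inl ⟨τ.dur_eq_zero ho, rfl⟩)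

theorem at_of_mem {i : ℕ} {t : ℝ} (ho : 0 < τ.dur i) (h1 : τ.time i < t)
    (h2 : t < τ.time (i + 1)) : τ.At i t :=
  τ.at_iff.2 (Or.inr ⟨ho, h1, h2⟩)

/-- An open interval contains points beyond any bound that is less than its right end. -/
theorem exists_at_gt {i : ℕ} {a : ℝ} (ho : 0 < τ.dur i) (ha : a < τ.time (i + 1)) :
    ∃ t, τ.At i t ∧ a < t := by
  obtain ⟨t, h1, h2⟩ := exists_between (max_lt (τ.time_lt_succ ho) ha)
  rw [max_lt_iff] at h1
  exact ⟨t, τ.at_of_mem ho h1.1 h2, h1.2⟩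

/-- Every interval contains points below any bound that exceeds its left end. -/
theorem exists_at_lt {i : ℕ} {a : ℝ} (ha : τ.time i < a) : ∃ t, τ.At i t ∧ t < a := by
  by_cases ho : 0 < τ.dur i
  · obtain ⟨t, h1, h2⟩ := exists_between (lt_min (τ.time_lt_succ ho) ha)
    rw [lt_min_iff] at h2
    exact ⟨t, τ.at_of_mem ho h1 h2.1, h2.2⟩
  · exact ⟨_, τ.at_time ho, ha⟩

theorem exists_at (i : ℕ) : ∃ t, τ.At i t := by
  obtain ⟨t, h, -⟩ := τ.exists_at_lt (lt_add_one (τ.time i))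
  exact ⟨t, h⟩

theorem exists_at_between {i : ℕ} {t t' : ℝ} (h : τ.At i t) (h' : τ.At i t') (hlt : t < t') :
    ∃ s, τ.At i s ∧ t < s ∧ s < t' := by
  obtain ⟨s, h1, h2⟩ := exists_between hlt
  by_cases ho : 0 < τ.dur i
  · exact ⟨s, τ.at_of_mem ho ((h.time_lt ho).trans h1) (h2.trans (h'.lt_time ho i.lt_succ_self)),
      h1, h2⟩
  · rw [h.eq_time ho, h'.eq_time ho] at hlt
    exact absurd hlt (lt_irrefl _)

theorem opn_of_lt {i : ℕ} {t t' : ℝ} (h : τ.At i t) (h' : τ.At i t') (hlt : t < t') :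
    0 < τ.dur i := by
  by_contra ho
  rw [h.eq_time ho, h'.eq_time ho] at hlt
  exact absurd hlt (lt_irrefl _)

/-! ## Truth of temporal formulas at the points of a run -/

variable {τ}

/-- `l` is a sound approximation of the truth of `φ`. -/
def Approx (τ : Run S) (φ : MITL AP) (l : ℕ → Prop) : Prop :=
  ∀ i, l i → ∀ t, τ.At i t → τ.trace.Sat φ i t

/-! ### Until without clocks: following an obligation -/

section Until

variable {α β : MITL AP} {l r : ℕ → Prop}

/-- A witness for an until-formula with `l` at all intervals that contain points strictly between. -/
theorem sat_until (hl : τ.Approx α l) {q : Ineq} {n i k : ℕ} {t t' : ℝ}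
    (hr : τ.trace.Sat β k t') (ht' : τ.At k t')
    (hlater : Earlier i t k t') (hq : q.holds (t' - t) n) (ht : τ.At i t)
    (h : ∀ j, i ≤ j → j ≤ k → (i < j ∨ 0 < τ.dur i) → (j < k ∨ 0 < τ.dur k) → l j) :
    τ.trace.Sat (.until q n α β) i t := by
  refine ⟨k, t', ⟨ht', hlater⟩, hq, hr, ?_⟩
  rintro j s ⟨hs, h1⟩ h2
  refine hl j (h j ?_ ?_ ?_ ?_) s hs
  · rcases h1 with h1 | h1 <;> omega
  · rcases h2 with h2 | h2 <;> omega
  -- A point strictly between that lies in interval `i` or `k` itself forces that interval to be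
  -- open, so `l` is not needed on a singleton end.
  · rcases h1 with h1 | ⟨rfl, h1⟩
    · exact Or.inl h1
    · exact Or.inr (τ.opn_of_lt ht hs h1)
  · rcases h2 with h2 | ⟨rfl, h2⟩
    · exact Or.inl h2
    · exact Or.inr (τ.opn_of_lt hs ht' h2)

/-- Following the obligation of an until-formula either leads to a witness or goes on forever. -/
theorem until_chain {ob : ℕ → Prop}
    (h1 : ∀ i, ob i ∧ 0 < τ.dur i → l i ∧ (r i ∨ r (i + 1) ∨ (l (i + 1) ∧ ob (i + 1))))
    (h2 : ∀ i, ob i ∧ ¬ 0 < τ.dur i →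
      (¬ 0 < τ.dur (i + 1) ∧ r (i + 1)) ∨ (l (i + 1) ∧ ob (i + 1)))
    {m : ℕ} (hm : ob m) :
    (∃ k ≥ m, r k ∧ (m < k ∨ 0 < τ.dur m) ∧
      ∀ j, m ≤ j → j ≤ k → (m < j ∨ 0 < τ.dur m) → (j < k ∨ 0 < τ.dur k) → l j) ∨
    ((0 < τ.dur m → l m) ∧ ∀ k > m, ob k ∧ l k) := by
  by_cases hc : ∀ k > m, ob k ∧ l k
  · exact Or.inr ⟨fun ho => (h1 m ⟨hm, ho⟩).1, hc⟩
  left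
  have hm0 : 0 < τ.dur m → l m := fun ho => (h1 m ⟨hm, ho⟩).1
  -- `k` is the last interval to which the obligation is passed on together with `l`. The constraint
  -- at `k` can then only be met by `r` at `k` or at `k + 1`.
  have hstep : ∃ k ≥ m, (∀ j, m < j → j ≤ k → ob j ∧ l j) ∧ ¬ (ob (k + 1) ∧ l (k + 1)) := by
    by_contra! hn
    refine hc fun k hk => ?_
    have : ∀ d, ∀ j, m < j → j ≤ m + d → ob j ∧ l j := by
      intro d
      induction d with
      | zero => intro j h h'; omega
      | succ d ih =>
        intro j h h'
        rcases Nat.lt_or_ge j (m + d + 1) with h3 | h3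
        · exact ih j h (by omega)
        · obtain rfl : j = m + d + 1 := by omega
          exact hn (m + d) (by omega) ih
    exact this k k hk (by omega)
  obtain ⟨k, hk, hall, hlast⟩ := hstep
  have hob : ob k := by
    rcases hk.eq_or_lt with rfl | h
    · exact hm
    · exact (hall k h le_rfl).1
  have hlj : ∀ j, m ≤ j → j ≤ k → (m < j ∨ 0 < τ.dur m) → l j := by
    intro j hj hjk h
    rcases hj.eq_or_lt with rfl | h'
    · exact hm0 (h.resolve_left (lt_irrefl _))
    · exact (hall j h' hjk).2
  -- A witness in a singleton has no earlier point in its own interval, so `l (k + 1)` is not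
  -- required.
  have hsucc : r (k + 1) → ¬ 0 < τ.dur (k + 1) → ∃ k ≥ m, r k ∧ (m < k ∨ 0 < τ.dur m) ∧
      ∀ j, m ≤ j → j ≤ k → (m < j ∨ 0 < τ.dur m) → (j < k ∨ 0 < τ.dur k) → l j := by
    intro hr ho
    refine ⟨k + 1, by omega, hr, Or.inl (by omega), fun j hj hjk h h' => hlj j hj ?_ h⟩
    have := h'.resolve_right ho
    omega
  by_cases ho : 0 < τ.dur k
  · rcases (h1 k ⟨hob, ho⟩).2 with h | h | h
    · refine ⟨k, hk, h, ?_, fun j hj hjk h _ => hlj j hj hjk h⟩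
      rcases hk.eq_or_lt with rfl | h'
      · exact Or.inr ho
      · exact Or.inl h'
    · exact hsucc h (τ.not_opn_succ ho)
    · exact absurd h.symm hlast
  · rcases h2 k ⟨hob, ho⟩ with h | h
    · exact hsucc h.2 h.1
    · exact absurd h.symm hlast

/-- An obligation that never ends turns fairness into infinitely many intervals with `r`. By
non-zenoness one of them lies more than `n` time units ahead, which meets any lower bound. -/
theorem sat_until_of_forever (hl : τ.Approx α l) (hr : τ.Approx β r) {ob : ℕ → Prop}
    (hf : ∃ᶠ i in atTop, ¬ ob i ∨ r i) {q : Ineq} {n i m : ℕ} (hq : ∀ d : ℝ, d > n → q.holds d n)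
    {t : ℝ} (ht : τ.At i t) (hi : 0 < τ.dur i → l i) (h : ∀ k > i, l k) (h' : ∀ k > m, ob k) :
    τ.trace.Sat (.until q n α β) i t := by
  obtain ⟨k, -, hk⟩ := τ.exists_time_gt (t + n) 0
  obtain ⟨j, ⟨hkj, hmj, hij⟩, hj⟩ := (hf.and_eventually ((eventually_ge_atTop k).and
    ((eventually_gt_atTop m).and (eventually_gt_atTop i)))).exists.imp fun _ h => h.symm
  obtain ⟨t', ht'⟩ := τ.exists_at j
  have hrj := hj.resolve_left (not_not.2 (h' j hmj))
  refine sat_until hl (hr j hrj t' ht') ht' (Or.inl hij) (hq _ ?_) ht ?_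
  · linarith [τ.time_mono hkj, ht'.time_le]
  · intro a ha _ hia _
    rcases ha.eq_or_lt with rfl | h0
    · exact hi (hia.resolve_left (lt_irrefl _))
    · exact h a h0

/-- Soundness of the constraints for `α Uˢ β`. -/
theorem sat_suntil (hl : τ.Approx α l) (hr : τ.Approx β r) {u : ℕ → Prop}
    (h1 : ∀ i, u i ∧ 0 < τ.dur i → l i ∧ (r i ∨ r (i + 1) ∨ (l (i + 1) ∧ u (i + 1))))
    (h2 : ∀ i, u i ∧ ¬ 0 < τ.dur i →
      (¬ 0 < τ.dur (i + 1) ∧ r (i + 1)) ∨ (l (i + 1) ∧ u (i + 1)))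
    (hf : ∃ᶠ i in atTop, ¬ u i ∨ r i) : τ.Approx (.suntil α β) u := by
  intro i hi t ht
  rcases until_chain h1 h2 hi with ⟨k, hk, hrk, hik, h⟩ | ⟨hi', h⟩
  -- If the witness interval is `i` itself, it is open, and the strict semantics needs a point of it
  -- to the right of `t`.
  · have : ∃ t', τ.At k t' ∧ Earlier i t k t' ∧ t ≤ t' := by
      by_cases hlt : i < k
      · obtain ⟨t', ht'⟩ := τ.exists_at k
        exact ⟨t', ht', Or.inl hlt, (ht.le_time hlt).trans ht'.time_le⟩
      · obtain rfl : i = k := by omega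
        have ho := hik.resolve_left hlt
        obtain ⟨t', ht', h⟩ := τ.exists_at_gt ho (ht.lt_time ho i.lt_succ_self)
        exact ⟨t', ht', Or.inr ⟨rfl, h⟩, h.le⟩
    obtain ⟨t', ht', he, hle⟩ := this
    refine sat_until hl (hr k hrk t' ht') ht' he ?_ ht h
    simpa [Ineq.holds] using hle
  · exact sat_until_of_forever (q := .ge) (n := 0) hl hr hf (fun d hd => le_of_lt hd) ht hi'
      (fun k hk => (h k hk).2)
      fun k hk => (h k hk).1

end Until

/-! ### Clocks restarted at every `u`, and until with a lower time bound -/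

section Clock

variable {u : ℕ → Prop} {c : ℕ → ℝ}

/-- A clock that is reset whenever `u` holds gives a lower bound of the time since a point at which
`u` held; the bound is strict when the last reset took place after an open interval. -/
theorem clock_le_of_reset {ri : ℕ → Prop}
    (h1 : ∀ i, u i → c (i + 1) = 0 ∧ (ri (i + 1) ↔ 0 < τ.dur i))
    (h2 : ∀ i, ¬ u i → c (i + 1) = c i + τ.dur i ∧ (ri (i + 1) ↔ ri i))
    {i : ℕ} (hi : u i) {t : ℝ} (ht : τ.At i t) {k : ℕ} (hk : i < k) :
    c k ≤ τ.time k - t ∧ (ri k → c k < τ.time k - t) := by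
  induction k, hk using Nat.le_induction with
  | base =>
    rw [(h1 i hi).1, (h1 i hi).2]
    exact ⟨by linarith [ht.le_time i.lt_succ_self],
      fun ho => by linarith [ht.lt_time ho i.lt_succ_self]⟩
  | succ k hk ih =>
    by_cases hu : u k
    -- A further reset only lowers the clock, so the bound measured from the older point `t`
    -- survives.
    · rw [(h1 k hu).1, (h1 k hu).2]
      have := ht.le_time hk
      exact ⟨by linarith [τ.time_mono k.le_succ], fun ho => by linarith [τ.time_lt_succ ho]⟩
    · rw [(h2 k hu).1, (h2 k hu).2, time_succ]
      exact ⟨by linarith [ih.1], fun h => by linarith [ih.2 h]⟩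

end Clock

/-- Soundness of the constraints for `α U_{> n} β` and `α U_{≥ n} β`. -/
theorem sat_untilLow {α β : MITL AP} {l r u ob ri θ : ℕ → Prop} {c : ℕ → ℝ} {q : Ineq} {n : ℕ}
    (hq : ∀ d : ℝ, d > n → q.holds d n)
    (hl : τ.Approx α l) (hr : τ.Approx β r)
    (hθ : ∀ i, θ i → c i + τ.dur i > n ∨ (ri i ∧ c i + τ.dur i ≥ n) ∨
      ((∀ d : ℝ, d ≥ n → q.holds d n) ∧ ¬ 0 < τ.dur i ∧ c i + τ.dur i ≥ n))
    (h0 : ∀ i, u i → ob i) (h0' : 0 < n → ∀ i, u i → ob (i + 1) ∧ l (i + 1))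
    (h1 : ∀ i, ob i ∧ 0 < τ.dur i →
      l i ∧ ((r i ∧ θ i) ∨ (r (i + 1) ∧ θ (i + 1)) ∨ (l (i + 1) ∧ ob (i + 1))))
    (h2 : ∀ i, ob i ∧ ¬ 0 < τ.dur i →
      (¬ 0 < τ.dur (i + 1) ∧ r (i + 1) ∧ θ (i + 1)) ∨ (l (i + 1) ∧ ob (i + 1)))
    (h3 : ∀ i, u i → c (i + 1) = 0 ∧ (ri (i + 1) ↔ 0 < τ.dur i))
    (h4 : ∀ i, ¬ u i → c (i + 1) = c i + τ.dur i ∧ (ri (i + 1) ↔ ri i))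
    (hf : ∃ᶠ i in atTop, ¬ ob i ∨ r i) : τ.Approx (.until q n α β) u := by
  intro i hi t ht
  have hli : 0 < τ.dur i → l i := fun ho => (h1 i ⟨h0 i hi, ho⟩).1
  -- a point of a later interval at which the timing condition holds
  have hpt : ∀ k, i < k → θ k → ∃ t', τ.At k t' ∧ q.holds (t' - t) n := by
    intro k hk hθk
    obtain ⟨hc, hc'⟩ := clock_le_of_reset h3 h4 hi ht hk
    -- The timing condition speaks about the right end of interval `k`. An open interval only
    -- approaches that end, hence the strict inequality; a singleton attains it.
    have hgt : τ.time (k + 1) - t > n → ∃ t', τ.At k t' ∧ q.holds (t' - t) n := by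
      intro h
      by_cases ho : 0 < τ.dur k
      · obtain ⟨t', ht', h'⟩ := τ.exists_at_gt (a := t + n) ho (by linarith)
        exact ⟨t', ht', hq _ (by linarith)⟩
      · rw [time_succ, τ.dur_eq_zero ho] at h
        exact ⟨_, τ.at_time ho, hq _ (by linarith)⟩
    rcases hθ k hθk with h | ⟨h, h'⟩ | ⟨h, ho, h'⟩
    · exact hgt (by rw [time_succ]; linarith)
    · exact hgt (by rw [time_succ]; linarith [hc' h])
    · rw [τ.dur_eq_zero ho] at h'
      exact ⟨_, τ.at_time ho, h _ (by linarith)⟩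
  -- For `n = 0` the obligation starts at `i` and may be met inside an open interval `i`. There `θ
  -- i` says nothing about `t`, since the reset only shows at `i + 1`, but any later point already
  -- has positive distance. For `n > 0` the chain starts at `i + 1`, where the clock is meaningful.
  rcases n.eq_zero_or_pos with hn | hn
  · rcases until_chain (r := fun i => r i ∧ θ i) h1 h2 (h0 i hi) with
      ⟨k, hk, ⟨hrk, hθk⟩, hik, h⟩ | ⟨-, h⟩
    · have : ∃ t', τ.At k t' ∧ q.holds (t' - t) n ∧ Earlier i t k t' := by
        by_cases hlt : i < k
        · obtain ⟨t', ht', h'⟩ := hpt k hlt hθk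
          exact ⟨t', ht', h', Or.inl hlt⟩
        · obtain rfl : i = k := by omega
          have ho := hik.resolve_left hlt
          obtain ⟨t', ht', h⟩ := τ.exists_at_gt ho (ht.lt_time ho i.lt_succ_self)
          exact ⟨t', ht', hq _ (by simpa [hn] using h), Or.inr ⟨rfl, h⟩⟩
      obtain ⟨t', ht', h', he⟩ := this
      exact sat_until hl (hr k hrk t' ht') ht' he h' ht h
    · exact sat_until_of_forever hl hr hf hq ht hli (fun k hk => (h k hk).2) fun k hk => (h k hk).1
  · obtain ⟨hob, hl'⟩ := h0' hn i hi
    rcases until_chain (r := fun i => r i ∧ θ i) h1 h2 hob with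
      ⟨k, hk, ⟨hrk, hθk⟩, -, h⟩ | ⟨-, h⟩
    · obtain ⟨t', ht', h'⟩ := hpt k hk hθk
      refine sat_until hl (hr k hrk t' ht') ht' (Or.inl hk) h' ht fun j hj hjk hij hjk' => ?_
      rcases Nat.lt_or_ge (i + 1) j with hlt | hge
      · exact h j hlt.le hjk (Or.inl hlt) hjk'
      · rcases hj.eq_or_lt with rfl | hj'
        · exact hli (hij.resolve_left (lt_irrefl _))
        -- The chain from `i + 1` omits `l` there when that interval is a singleton; the extra
        -- constraint for `n > 0` supplies it.
        · obtain rfl : j = i + 1 := by omega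
          exact hl'
    · refine sat_until_of_forever hl hr hf hq ht hli (fun k hk => ?_) fun k hk => (h k hk).1
      rcases Nat.lt_or_ge (i + 1) k with hlt | hge
      · exact (h k hlt).2
      · obtain rfl : k = i + 1 := by omega
        exact hl'

/-! ### Eventually with an upper time bound -/

section Eventually

variable {α : MITL AP} {r u : ℕ → Prop}

/-- Soundness of the constraint for `F_{≤ 0} α`. -/
theorem sat_evZero (hr : τ.Approx α r)
    (h : ∀ i, u i → ¬ 0 < τ.dur i ∧ ¬ 0 < τ.dur (i + 1) ∧ (r (i + 1) ∨ u (i + 1))) :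
    τ.Approx (.ev .le 0 α) u := by
  intro i hi t ht
  obtain ⟨k, hik, hk⟩ := τ.exists_time_gt t i
  by_contra hn
  have : ∀ k ≥ i, u k ∧ τ.time k = t := by
    intro k hk
    induction k, hk using Nat.le_induction with
    | base => exact ⟨hi, (ht.eq_time (h i hi).1).symm⟩
    | succ k hk ih =>
      obtain ⟨h1, h2, h3⟩ := h k ih.1
      have hT : τ.time (k + 1) = t := by rw [time_succ, τ.dur_eq_zero h1, ih.2, add_zero]
      refine ⟨h3.resolve_left fun h4 => hn ?_, hT⟩
      refine ⟨k + 1, t, ⟨hT ▸ τ.at_time h2, Or.inl (by omega)⟩, ?_, ?_⟩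
      · simp [Ineq.holds]
      · exact hr _ h4 _ (hT ▸ τ.at_time h2)
  linarith [(this k hik).2]

/-- Soundness of the constraints for `F_{< n} α` and `F_{≤ n} α`. -/
theorem sat_ev {lf θ : ℕ → Prop} {c : ℕ → ℝ} {q : Ineq} {n : ℕ} (hn : 0 < n)
    (hq : ∀ d : ℝ, d < n → q.holds d n) (hr : τ.Approx α r) (hc : ∀ i, 0 ≤ c i) (hlf : ¬ lf 0)
    (hθ : ∀ i, θ i → c i + τ.dur i < n ∨ (lf i ∧ c i + τ.dur i ≤ n) ∨
      ((∀ d : ℝ, d ≤ n → q.holds d n) ∧ ¬ 0 < τ.dur (i + 1) ∧ c i + τ.dur i ≤ n))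
    (h1 : ∀ i, u i ∧ 0 < τ.dur i → r i ∨ r (i + 1) ∨ u (i + 1))
    (h2 : ∀ i, u i ∧ ¬ 0 < τ.dur i → r (i + 1) ∨ u (i + 1))
    (h3 : ∀ i, (¬ u i ∨ (0 < τ.dur i ∧ r i) ∨ r (i + 1)) ∧ u (i + 1) →
      c (i + 1) = 0 ∧ (lf (i + 1) ↔ 0 < τ.dur (i + 1)))
    (h4 : ∀ i, ¬ ((¬ u i ∨ (0 < τ.dur i ∧ r i) ∨ r (i + 1)) ∧ u (i + 1)) →
      c (i + 1) = c i + τ.dur i ∧ (lf (i + 1) ↔ lf i))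
    (h5 : ∀ i, u i ∧ ¬ (r i ∧ 0 < τ.dur i) → θ i) : τ.Approx (.ev q n α) u := by
  intro i hi t ht
  -- The flag records a reset on entry to an open interval: either the run is still in that
  -- interval, or its positive duration is already on the clock. The base case needs `lefto` to be
  -- false initially.
  have hinv : ∀ i, lf i → 0 < τ.dur i ∨ 0 < c i := by
    intro i
    induction i with
    | zero => exact fun h => absurd h hlf
    | succ i ih =>
      intro h
      by_cases hρ : (¬ u i ∨ (0 < τ.dur i ∧ r i) ∨ r (i + 1)) ∧ u (i + 1)
      · exact Or.inl ((h3 i hρ).2.1 h)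
      · rw [(h4 i hρ).1]
        right
        rcases ih ((h4 i hρ).2.1 h) with h' | h'
        · linarith [hc i]
        · linarith [τ.dur_nonneg i]
  -- a witness in the next interval
  have hwit : ∀ k, i ≤ k → τ.time k - t ≤ c k → (lf k → τ.time k - t < c k) → θ k →
      r (k + 1) → τ.trace.Sat (.ev q n α) i t := by
    intro k hk hck hlk hθk hrk
    have hlt : τ.time (k + 1) - t < n → τ.trace.Sat (.ev q n α) i t := by
      intro h
      obtain ⟨t', ht', h'⟩ := τ.exists_at_lt (i := k + 1) (a := t + n) (by linarith)
      exact ⟨k + 1, t', ⟨ht', Or.inl (by omega)⟩, hq _ (by linarith), hr _ hrk _ ht'⟩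
    rcases hθ k hθk with h | ⟨h, h'⟩ | ⟨h, ho, h'⟩
    · exact hlt (by rw [time_succ]; linarith)
    · exact hlt (by rw [time_succ]; linarith [hlk h])
    · refine ⟨k + 1, _, ⟨τ.at_time ho, Or.inl (by omega)⟩, h _ ?_, hr _ hrk _ (τ.at_time ho)⟩
      rw [time_succ]
      linarith
  by_contra hns
  -- In an open interval with `r`, a point just after `t` is a witness, whatever the clock says;
  -- this uses `0 < n`.
  have hno : ¬ (r i ∧ 0 < τ.dur i) := by
    rintro ⟨hri, ho⟩
    have hnn : (0 : ℝ) < n := by exact_mod_cast hn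
    obtain ⟨t', h1, h2⟩ := exists_between
      (lt_min (ht.lt_time ho i.lt_succ_self) (lt_add_of_pos_right t hnn))
    rw [lt_min_iff] at h2
    have ht' := τ.at_of_mem ho ((ht.time_lt ho).trans h1) h2.1
    exact hns ⟨i, t', ⟨ht', Or.inr ⟨rfl, h1⟩⟩, hq _ (by linarith), hr _ hri _ ht'⟩
  -- Without a witness the reset condition fails at every step, so the clock runs on. It may have
  -- started before `t`, so it is an upper bound for the elapsed time.
  have hall : ∀ k ≥ i, u k ∧ ¬ (r k ∧ 0 < τ.dur k) ∧ τ.time k - t ≤ c k ∧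
      (lf k → τ.time k - t < c k) := by
    intro k hk
    induction k, hk using Nat.le_induction with
    | base =>
      refine ⟨hi, hno, by linarith [ht.time_le, hc i], fun h => ?_⟩
      rcases hinv i h with h' | h'
      · linarith [ht.time_lt h', hc i]
      · linarith [ht.time_le]
    | succ k hk ih =>
      obtain ⟨hu, hnr, hck, hlk⟩ := ih
      have hnr' : ¬ r (k + 1) := fun h => hns (hwit k hk hck hlk (h5 k ⟨hu, hnr⟩) h)
      have hu' : u (k + 1) := by
        by_cases ho : 0 < τ.dur k
        · have := h1 k ⟨hu, ho⟩
          tauto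
        · have := h2 k ⟨hu, ho⟩
          tauto
      obtain ⟨h6, h7⟩ := h4 k (by tauto)
      refine ⟨hu', fun h => hnr' h.1, ?_, fun h => ?_⟩
      · rw [h6, time_succ]; linarith
      · rw [h6, time_succ]; linarith [hlk (h7.1 h)]
  -- Past time `t + n` the clock exceeds `n`, while every form of the timing condition keeps it at
  -- most `n`.
  obtain ⟨k, hik, hk⟩ := τ.exists_time_gt (t + n) i
  obtain ⟨hu, hnr, hck, -⟩ := hall k hik
  have := τ.dur_nonneg k
  rcases hθ k (h5 k ⟨hu, hnr⟩) with h | ⟨-, h⟩ | ⟨-, -, h⟩ <;> linarith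

end Eventually

/-! ### Always with an upper time bound -/

section Always

variable {α : MITL AP} {r u : ℕ → Prop}

/-- Soundness of the constraint for `G_{≤ 0} α`. -/
theorem sat_alwZero (hr : τ.Approx α r)
    (h : ∀ i, u i → 0 < τ.dur i ∨ 0 < τ.dur (i + 1) ∨ (r (i + 1) ∧ u (i + 1))) :
    τ.Approx (.alw .le 0 α) u := by
  rintro i hi t ht k t' ⟨ht', he⟩ hq
  replace ht' : τ.At k t' := ht'
  replace hq : t' ≤ t := by simpa [Ineq.holds] using hq
  have hik : i < k := he.resolve_right fun h => by linarith [h.2]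
  -- No time passes between the two points, so an open interval cannot occur among `i, …, k` and the
  -- constraint passes `u` on at each step.
  have hno : ∀ j, i ≤ j → j ≤ k → ¬ 0 < τ.dur j := by
    intro j hj hjk ho
    rcases hj.eq_or_lt with rfl | hij
    · linarith [ht.lt_time ho hik, ht'.time_le]
    · rcases hjk.eq_or_lt with rfl | hjk'
      · linarith [ht.le_time hij, ht'.time_lt ho]
      · have h1 : τ.time (j + 1) ≤ τ.time k := τ.time_mono hjk'
        linarith [ht.le_time hij, ht'.time_le, τ.time_lt_succ ho]
  have hall : ∀ j, i < j → j ≤ k → r j ∧ u j := by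
    intro j hj
    induction j, hj using Nat.le_induction with
    | base =>
      intro hk
      exact ((h i hi).resolve_left (hno i le_rfl (by omega))).resolve_left
        (hno _ (by omega) hk)
    | succ j hj ih =>
      intro hk
      exact ((h j (ih (by omega)).2).resolve_left (hno j (by omega) (by omega))).resolve_left
        (hno _ (by omega) hk)
  exact hr k (hall k hik le_rfl).1 t' ht'

/-- Soundness of the constraints for `G_{< n} α` and `G_{≤ n} α`. -/
theorem sat_alw {ri θ : ℕ → Prop} {c : ℕ → ℝ} {q : Ineq} {n : ℕ} (hr : τ.Approx α r)
    (hθ : ∀ i (d : ℝ), q.holds d n →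
      (c i < d ∨ (c i = d ∧ (q = .le → ¬ 0 < τ.dur i ∧ ¬ ri i))) → θ i)
    (h1 : ∀ i, (u i ∧ 0 < τ.dur i) ∨ θ i → r i)
    (h2 : ∀ i, u i → c (i + 1) = 0 ∧ (ri (i + 1) ↔ 0 < τ.dur i))
    (h3 : ∀ i, ¬ u i → c (i + 1) = c i + τ.dur i ∧ (ri (i + 1) ↔ ri i)) :
    τ.Approx (.alw q n α) u := by
  rintro i hi t ht k t' ⟨ht', he⟩ hq
  replace ht' : τ.At k t' := ht'
  refine hr k (h1 k ?_) t' ht'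
  rcases he with hik | ⟨rfl, hlt⟩
  · right
    obtain ⟨hc, hc'⟩ := clock_le_of_reset h2 h3 hi ht hik
    refine hθ k _ hq ?_
    rcases (hc.trans (sub_le_sub_right ht'.time_le t)).lt_or_eq with h | h
    · exact Or.inl h
    -- Equality makes all the estimates tight. An open interval `k` or a last reset after an open
    -- interval would make one of them strict.
    · refine Or.inr ⟨h, fun _ => ⟨fun ho => ?_, fun hri => ?_⟩⟩
      · linarith [ht'.time_lt ho]
      · linarith [hc' hri, ht'.time_le]
  · exact Or.inl ⟨hi, τ.opn_of_lt ht ht' hlt⟩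

end Always

/-! ### Release, untimed and with a lower time bound -/

section Release

variable {α β : MITL AP} {l r u ob : ℕ → Prop}

/-- If the obligation of a release-formula is pending at interval `m`, and holds for points that
come after `(i, t)`, then it suffices to consider later intervals that the obligation reaches
without meeting `l`. -/
theorem release_chain (hl : τ.Approx α l) (hr : τ.Approx β r) {i m k : ℕ} {t t' : ℝ}
    (ht : τ.At i t) (ht' : τ.At k t') (he : Earlier i t k t')
    (hm : (m = i ∧ 0 < τ.dur i) ∨ m = i + 1) (hob : ob m) (hmk : m ≤ k)
    (h1 : ∀ i, ob i → l i ∨ ob (i + 1))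
    (h2 : (∀ j, m ≤ j → j < k → ob j ∧ ¬ l j) → ob k → (l k ∧ 0 < τ.dur k) ∨ r k)
    (hβ : ¬ τ.trace.Sat β k t') :
    ∃ i'' t'', τ.trace.Later i t i'' t'' ∧ Earlier i'' t'' k t' ∧ τ.trace.Sat α i'' t'' := by
  -- Any interval before `k` with `l`, from `m` on, contains a releasing point. If that interval is
  -- `i`, it is open, and a point to the right of `t` is chosen.
  have hpt : ∀ j, m ≤ j → j < k → l j →
      ∃ i'' t'', τ.trace.Later i t i'' t'' ∧ Earlier i'' t'' k t' ∧ τ.trace.Sat α i'' t'' := by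
    intro j hj hjk hlj
    by_cases hij : i < j
    · obtain ⟨s, hs⟩ := τ.exists_at j
      exact ⟨j, s, ⟨hs, Or.inl hij⟩, Or.inl hjk, hl j hlj s hs⟩
    · obtain ⟨rfl, ho⟩ := hm.resolve_right (by omega)
      obtain rfl : j = m := by omega
      obtain ⟨s, hs, hts⟩ := τ.exists_at_gt ho (ht.lt_time ho j.lt_succ_self)
      exact ⟨j, s, ⟨hs, Or.inr ⟨rfl, hts⟩⟩, Or.inl hjk, hl j hlj s hs⟩
  by_contra hns
  have hall : ∀ j, m ≤ j → j ≤ k → ob j := by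
    intro j hj
    induction j, hj using Nat.le_induction with
    | base => exact fun _ => hob
    | succ j hj ih =>
      intro hk
      exact (h1 j (ih (by omega))).resolve_left fun h => hns (hpt j hj (by omega) h)
  -- Absent a releasing point the obligation reaches `k`. There `r` contradicts the failure of β,
  -- and `l` on an open interval releases at a point just before `t'`.
  rcases h2 (fun j hj hjk => ⟨hall j hj hjk.le, fun h => hns (hpt j hj hjk h)⟩)
    (hall k hmk le_rfl) with ⟨hlk, ho⟩ | h
  · rcases he with hik | ⟨rfl, hlt⟩
    · obtain ⟨s, hs, hst⟩ := τ.exists_at_lt (ht'.time_lt ho)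
      exact hns ⟨k, s, ⟨hs, Or.inl hik⟩, Or.inr ⟨rfl, hst⟩, hl k hlk s hs⟩
    · obtain ⟨s, hs, hts, hst⟩ := τ.exists_at_between ht ht' hlt
      exact hns ⟨i, s, ⟨hs, Or.inr ⟨rfl, hts⟩⟩, Or.inr ⟨rfl, hst⟩, hl i hlk s hs⟩
  · exact hβ (hr k h t' ht')

/-- Soundness of the constraints for `α Rˢ β`. -/
theorem sat_srelease (hl : τ.Approx α l) (hr : τ.Approx β r)
    (h1 : ∀ i, u i ∧ 0 < τ.dur i → ob i) (h2 : ∀ i, u i ∧ ¬ 0 < τ.dur i → ob (i + 1))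
    (h3 : ∀ i, ob i → l i ∨ ob (i + 1)) (h4 : ∀ i, ob i → (0 < τ.dur i ∧ l i) ∨ r i) :
    τ.Approx (.srelease α β) u := by
  rintro i hi t ht k t' ⟨ht', he⟩ ⟨-, hβ⟩
  have h4' : ∀ i, ob i → (l i ∧ 0 < τ.dur i) ∨ r i := fun i h => by
    have := h4 i h
    tauto
  -- In an open interval later points of `i` itself are constrained, so the obligation starts at
  -- `i`; after a singleton it starts at `i + 1`.
  by_cases ho : 0 < τ.dur i
  · exact release_chain hl hr ht ht' he (Or.inl ⟨rfl, ho⟩) (h1 i ⟨hi, ho⟩)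
      (by rcases he with he | he <;> omega) h3 (fun _ => h4' k) hβ
  · refine release_chain hl hr ht ht' he (Or.inr rfl) (h2 i ⟨hi, ho⟩) ?_ h3 (fun _ => h4' k) hβ
    rcases he with he | ⟨rfl, hlt⟩
    · exact he
    · exact absurd (τ.opn_of_lt ht ht' hlt) ho

/-- Soundness of the constraints for `α R_{> n} β` and `α R_{≥ n} β`. -/
theorem sat_releaseLow {lf θ : ℕ → Prop} {c : ℕ → ℝ} {q : Ineq} {n : ℕ}
    (hq : ∀ d : ℝ, q.holds d n → d ≥ n)
    (hl : τ.Approx α l) (hr : τ.Approx β r) (hc : ∀ i, 0 ≤ c i) (hlf : ¬ lf 0)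
    (hθ : ∀ i, c i + τ.dur i > n → θ i)
    (hθ' : ∀ i, ¬ lf i → ¬ 0 < τ.dur i → q.holds (c i + τ.dur i) n → θ i)
    (h1 : ∀ i, u i ∧ 0 < τ.dur i → ob i) (h2 : ∀ i, u i ∧ ¬ 0 < τ.dur i → ob (i + 1))
    (h3 : ∀ i, ob i → l i ∨ ob (i + 1)) (h4 : ∀ i, ob i ∧ θ i → (l i ∧ 0 < τ.dur i) ∨ r i)
    (h5 : ∀ i, u i ∧ τ.dur i > n → l i ∨ r i)
    (h6 : ∀ i, ¬ 0 < τ.dur i ∧ ob i ∧ l i ∧ u i → c (i + 1) = 0 ∧ ¬ lf (i + 1))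
    (h7 : ∀ i, u (i + 1) ∧ (¬ ob i ∨ l i) ∧ (0 < τ.dur i ∨ ¬ u i) →
      c (i + 1) = 0 ∧ (lf (i + 1) ↔ 0 < τ.dur (i + 1)))
    (h8 : ∀ i, ¬ (u (i + 1) ∧ (¬ ob i ∨ l i) ∧ (0 < τ.dur i ∨ ¬ u i)) ∧
      ¬ (¬ 0 < τ.dur i ∧ ob i ∧ l i ∧ u i) →
        c (i + 1) = c i + τ.dur i ∧ (lf (i + 1) ↔ lf i)) :
    τ.Approx (.release q n α β) u := by
  have hinv : ∀ i, lf i → 0 < τ.dur i ∨ 0 < c i := by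
    intro i
    induction i with
    | zero => exact fun h => absurd h hlf
    | succ i ih =>
      intro h
      by_cases hρ : u (i + 1) ∧ (¬ ob i ∨ l i) ∧ (0 < τ.dur i ∨ ¬ u i)
      · exact Or.inl ((h7 i hρ).2.1 h)
      · have hD : ¬ (¬ 0 < τ.dur i ∧ ob i ∧ l i ∧ u i) := fun hD => (h6 i hD).2 h
        obtain ⟨h9, h10⟩ := h8 i ⟨hρ, hD⟩
        rw [h9]
        right
        rcases ih (h10.1 h) with h' | h'
        · linarith [hc i]
        · linarith [τ.dur_nonneg i]
  -- the clock advances as long as the obligation is pending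
  have hadv : ∀ m k, m ≤ k → (∀ j, m ≤ j → j < k → ob j ∧ ¬ l j) →
      c k = c m + (τ.time k - τ.time m) ∧ (lf k ↔ lf m) := by
    intro m k hk
    induction k, hk using Nat.le_induction with
    | base => simp
    | succ k hk ih =>
      intro h
      obtain ⟨h9, h10⟩ := ih fun j hj hjk => h j hj (by omega)
      have hk' := h k hk k.lt_succ_self
      obtain ⟨h11, h12⟩ := h8 k (by tauto)
      rw [h11, h12, h9, time_succ]
      exact ⟨by ring, h10⟩
  rintro i hi t ht k t' ⟨ht', he⟩ ⟨hqt, hβ⟩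
  replace ht' : τ.At k t' := ht'
  have hge := hq _ hqt
  by_cases ho : 0 < τ.dur i
  · refine release_chain hl hr ht ht' he (Or.inl ⟨rfl, ho⟩) (h1 i ⟨hi, ho⟩)
      (by rcases he with he | he <;> omega) h3 (fun hall hob => ?_) hβ
    rcases he with hik | ⟨rfl, hlt⟩
    -- Since the clock has run at least since `τ.time i < t`, it strictly exceeds the elapsed time,
    -- and no borderline case arises.
    · refine h4 k ⟨hob, hθ k ?_⟩
      rw [(hadv i k hik.le hall).1]
      have := ht'.le_time k.lt_succ_self
      rw [time_succ] at this
      linarith [hc i, ht.time_lt ho]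
    -- Both points lie in one open interval, which is therefore longer than `n`. This is what the
    -- separate constraint on `δ > n` is for, independently of the clock.
    · have := ht'.lt_time ho i.lt_succ_self
      rw [time_succ] at this
      have := h5 i ⟨hi, by linarith [ht.time_le]⟩
      tauto
  · have hik : i < k := he.resolve_right fun h => by
      obtain ⟨rfl, hlt⟩ := h
      exact ho (τ.opn_of_lt ht ht' hlt)
    refine release_chain hl hr ht ht' he (Or.inr rfl) (h2 i ⟨hi, ho⟩) hik h3
      (fun hall hob => h4 k ⟨hob, ?_⟩) hβ
    obtain ⟨h9, h10⟩ := hadv (i + 1) k hik hall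
    have hti : τ.time (i + 1) = t := by
      rw [time_succ, τ.dur_eq_zero ho, add_zero, ht.eq_time ho]
    rw [hti] at h9
    have hci := hc (i + 1)
    by_cases hok : 0 < τ.dur k
    · apply hθ
      have := ht'.lt_time hok k.lt_succ_self
      rw [time_succ] at this
      linarith
    · rw [ht'.eq_time hok] at hge hqt
      -- Only singletons at both ends with the clock at exactly 0 after `i` can give equality. Then
      -- `lefto` must be false: the delayed reset clears it, and an inherited true flag would by
      -- `hinv` need an open interval `i` or a positive clock.
      rcases hci.eq_or_lt with h0 | h0
      · have hnlf : ¬ lf (i + 1) := by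
          by_cases hD : ¬ 0 < τ.dur i ∧ ob i ∧ l i ∧ u i
          · exact (h6 i hD).2
          · obtain ⟨h11, h12⟩ := h8 i ⟨by tauto, hD⟩
            rw [h12]
            intro h
            rcases hinv i h with h' | h'
            · exact ho h'
            · linarith [τ.dur_nonneg i]
        refine hθ' k (by tauto) hok ?_
        rwa [h9, ← h0, τ.dur_eq_zero hok, zero_add, add_zero]
      · apply hθ
        rw [τ.dur_eq_zero hok]
        linarith

end Release

end Run

/-! ## Runs of an extended system -/

section Extend

variable {V : Sig} {w y : ℕ}

theorem nval_sat_lift (z : NVal (V.extend w y)) (f : BForm (ZAtom V)) :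
    z.sat (f.map ZAtom.lift) ↔ z.restrict.sat f := by
  unfold NVal.sat
  rw [BForm.eval_map]
  rfl

theorem state_sat_lift (s : State (V.extend w y)) (f : BForm (StAtom V)) :
    s.sat (f.map StAtom.lift) ↔ s.restrict.sat f := by
  unfold State.sat
  rw [BForm.eval_map]
  have : (fun a => s.satAtom (StAtom.lift a)) = s.restrict.satAtom := by
    funext a
    cases a <;> rfl
  rw [this]

/-- The state of the extended system with given values of the fresh variables. -/
def State.adjoin (s : State V) (z : Fin w → Bool) (c : Fin y → ℝ) : State (V.extend w y) where
  bool := Sum.elim s.bool z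
  val := s.val
  clk := Sum.elim s.clk c

variable {AP : Type*} {S : TransSys AP}
  {I : BForm (StAtom (S.sig.extend w y))} {T : BForm (TrAtom (S.sig.extend w y))}
  {F : List (BForm (ZAtom (S.sig.extend w y)))}
  {hT : ∀ s δ s' δ', stepSat s δ s' δ' T → ∀ c : Fin y,
      s'.clk (Sum.inr c) = 0 ∨ s'.clk (Sum.inr c) = s.clk (Sum.inr c) + δ}

/-- Restriction of a run of an extended system to the old variables. -/
def Run.restrict (τ : Run (S.extend w y I T F hT)) : Run S where
  st i := (τ.st i).restrict
  dur := τ.dur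
  dur_zero := τ.dur_zero
  dur_nonneg := τ.dur_nonneg
  clk_nonneg i _ := τ.clk_nonneg i _
  dur_alt := τ.dur_alt
  init := (state_sat_lift _ _).1 τ.init.1
  inv i := (state_sat_lift _ _).1 (τ.inv i)
  trans i := (stepSat_lift _ _ _ _ _).1 (τ.trans i).1
  fair f hf := (τ.fair (f.map ZAtom.lift)
    (List.mem_append_left _ (List.mem_map_of_mem hf))).mono fun _ => (nval_sat_lift _ _).1
  nonzeno := τ.nonzeno

theorem Run.trace_restrict (τ : Run (S.extend w y I T F hT)) :
    τ.restrict.trace = τ.trace := by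
  ext i x
  · rfl
  · exact (nval_sat_lift _ _).symm

/-- Extension of a run by values of the fresh variables. -/
def Run.adjoin (τ : Run S) (z : ℕ → Fin w → Bool) (c : ℕ → Fin y → ℝ) (hc : ∀ i x, 0 ≤ c i x)
    (hI : ((τ.st 0).adjoin (z 0) (c 0)).sat I)
    (hTr : ∀ i, stepSat ((τ.st i).adjoin (z i) (c i)) (τ.dur i)
      ((τ.st (i + 1)).adjoin (z (i + 1)) (c (i + 1))) (τ.dur (i + 1)) T)
    (hF : ∀ f ∈ F, ∀ i, ((τ.st i).adjoin (z i) (c i)).toNVal.sat f) :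
    Run (S.extend w y I T F hT) where
  st i := (τ.st i).adjoin (z i) (c i)
  dur := τ.dur
  dur_zero := τ.dur_zero
  dur_nonneg := τ.dur_nonneg
  clk_nonneg i x := by
    rcases x with x | x
    · exact τ.clk_nonneg i x
    · exact hc i x
  dur_alt := τ.dur_alt
  init := ⟨(state_sat_lift _ _).2 τ.init, hI⟩
  inv i := (state_sat_lift _ _).2 (τ.inv i)
  trans i := ⟨(stepSat_lift _ _ _ _ _).2 (τ.trans i), hTr i⟩
  fair f hf := by
    rcases List.mem_append.1 hf with h | h
    · obtain ⟨g, hg, rfl⟩ := List.mem_map.1 h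
      exact (τ.fair g hg).mono fun i =>
        (nval_sat_lift ((τ.st i).adjoin (z i) (c i)).toNVal g).2
    · exact Frequently.of_forall (hF f h)
  nonzeno := τ.nonzeno

/-- One inclusion is restriction. For the other, fairness is asked at every state, which is more
than a run needs but suffices for the chosen fresh values. -/
theorem traces_extend
    (h : ∀ τ : Run S, ∃ (z : ℕ → Fin w → Bool) (c : ℕ → Fin y → ℝ), (∀ i x, 0 ≤ c i x) ∧
      ((τ.st 0).adjoin (z 0) (c 0)).sat I ∧
      (∀ i, stepSat ((τ.st i).adjoin (z i) (c i)) (τ.dur i)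
        ((τ.st (i + 1)).adjoin (z (i + 1)) (c (i + 1))) (τ.dur (i + 1)) T) ∧
      ∀ f ∈ F, ∀ i, ((τ.st i).adjoin (z i) (c i)).toNVal.sat f) :
    (S.extend w y I T F hT).traces = S.traces := by
  apply Set.Subset.antisymm
  · rintro _ ⟨τ, rfl⟩
    exact ⟨τ.restrict, τ.trace_restrict⟩
  · rintro _ ⟨τ, rfl⟩
    obtain ⟨z, c, hc, hI, hTr, hF⟩ := h τ
    refine ⟨τ.adjoin z c hc hI hTr hF, ?_⟩
    rw [← Run.trace_restrict]
    rfl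

/-- The traces do not change if the constraints on the fresh variables hold when all fresh Boolean
variables are false and the fresh clocks are never reset, starting from some value. -/
theorem traces_extend_false (a : ℕ)
    (hI : ∀ s : State S.sig, (s.adjoin (fun _ => false) fun _ => a).sat I)
    (hTr : ∀ (s s' : State S.sig) (δ δ' : ℝ) (c : Fin y → ℝ), (∀ x, a ≤ c x) →
      stepSat (s.adjoin (fun _ => false) c) δ (s'.adjoin (fun _ => false) fun x => c x + δ) δ' T)
    (hF : ∀ f ∈ F, ∀ (s : State S.sig) (c : Fin y → ℝ),
      (s.adjoin (fun _ => false) c).toNVal.sat f) :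
    (S.extend w y I T F hT).traces = S.traces := by
  refine traces_extend fun τ => ⟨fun _ _ => false, fun i _ => a + τ.time i, fun i _ => ?_, ?_,
    fun i => ?_, fun f hf i => hF f hf _ _⟩
  · exact add_nonneg a.cast_nonneg (τ.time_nonneg i)
  · simpa [Run.time] using hI (τ.st 0)
  · have := hTr (τ.st i) (τ.st (i + 1)) (τ.dur i) (τ.dur (i + 1)) (fun _ => a + τ.time i)
      fun _ => by linarith [τ.time_nonneg i]
    simpa only [τ.time_succ, ← add_assoc] using this

end Extend

/-! ### Transfer of soundness along an extension -/

section SoundEncoding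

variable {AP : Type*}

variable {S : TransSys AP} {E : EncSys AP} {φ : MITL AP} {w y : ℕ}
  {I : BForm (StAtom (E.sig.extend (w + 1) y))} {T : BForm (TrAtom (E.sig.extend (w + 1) y))}
  {F : List (BForm (ZAtom (E.sig.extend (w + 1) y)))}
  {hT : ∀ s δ s' δ', stepSat s δ s' δ' T → ∀ c : Fin y,
      s'.clk (Sum.inr c) = 0 ∨ s'.clk (Sum.inr c) = s.clk (Sum.inr c) + δ}

/-- The Boolean variable `v` along a run. -/
def Run.holds {S : TransSys AP} (τ : Run S) (v : S.sig.B) (i : ℕ) : Prop :=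
  (τ.st i).bool v = true

/-- Restriction changes neither the trace nor the old variables, so soundness for the restricted run
is soundness for the extended one. -/
theorem SoundEncoding.approx {α : MITL AP} {a : E.sig.B} (h : SoundEncoding S E α)
    (ha : E.enc α = some a) (τ : Run (E.toTransSys.extend (w + 1) y I T F hT)) :
    τ.Approx α (τ.holds (.inl a)) := by
  intro i hi t ht
  rw [← τ.trace_restrict]
  rw [Run.At, ← τ.trace_restrict] at ht
  exact h.2.2 τ.restrict i a ha hi t ht

/-- The first fresh variable becomes `[φ]`, overriding any earlier designation, so old variables are
needed only for sub-formulas other than φ. -/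
theorem soundEncoding_extend (hsub : ∀ ψ ∈ φ.subformulas, ψ = φ ∨ ∃ b, E.enc ψ = some b)
    (htr : (E.toTransSys.extend (w + 1) y I T F hT).traces = S.traces)
    (h : ∀ τ : Run (E.toTransSys.extend (w + 1) y I T F hT),
      τ.Approx φ (τ.holds (.inr 0))) :
    SoundEncoding S (E.extend φ w y I T F hT) φ := by
  refine ⟨fun ψ hψ => ?_, htr, fun τ i b hb hi t ht => ?_⟩
  · by_cases hφ : ψ = φ
    · exact ⟨_, if_pos hφ⟩
    · obtain ⟨b, hb⟩ := (hsub ψ hψ).resolve_left hφ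
      exact ⟨.inl b, by simp [hφ, hb]⟩
  · obtain rfl : Sum.inr 0 = b := by simpa using hb
    exact h τ i hi t ht

end SoundEncoding

/-! ## Soundness of the encoding of each operator -/

namespace EncSys

open Enc

attribute [local simp] stepSat stepSatAtom State.sat State.satAtom NVal.sat BForm.eval BForm.conj
  Cmp.holds State.adjoin cur nxt opn opnN reset adv cd cdN initClock Enc.var Ineq.holds Run.holds

theorem stepSat_here {V : Sig} {s : State V} {δ : ℝ} {s' : State V} {δ' : ℝ}
    {f : BForm (ZAtom V)} : stepSat s δ s' δ' (here f) ↔ s.toNVal.sat f := by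
  unfold stepSat here
  rw [BForm.eval_map]
  rfl

variable {AP : Type*} {S : TransSys AP} {E : EncSys AP} {α β : MITL AP} {a b : E.sig.B}

/-- The constraint is an equivalence, so the fresh variable cannot simply be false; along an old run
it takes the truth value of the formula for `p`. -/
theorem sound_encAtom (p : AP) : SoundEncoding E.toTransSys (E.encAtom p) (.atom p) := by
  classical
  refine soundEncoding_extend (fun ψ h => Or.inl h) (traces_extend fun τ =>
    ⟨fun i _ => decide ((τ.st i).toNVal.sat (E.prop p)), fun _ _ => 0, fun _ _ => le_rfl,
      by trivial, fun i => ?_, by simp⟩) fun τ i hi t ht => stepSat_here.1 ((τ.trans i).2.1 hi)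
  refine Iff.trans ?_ (stepSat_here.trans (nval_sat_lift _ _)).symm
  exact decide_eq_true_iff

theorem sound_encNegAtom (p : AP) :
    SoundEncoding E.toTransSys (E.encNegAtom p) (.negAtom p) := by
  classical
  refine soundEncoding_extend (fun ψ h => Or.inl h) (traces_extend fun τ =>
    ⟨fun i _ => decide (¬ (τ.st i).toNVal.sat (E.prop p)), fun _ _ => 0, fun _ _ => le_rfl,
      by trivial, fun i => ?_, by simp⟩) fun τ i hi t ht h => (τ.trans i).2.1 hi (stepSat_here.2 h)
  refine Iff.trans ?_ (not_congr (stepSat_here.trans (nval_sat_lift _ _))).symm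
  exact decide_eq_true_iff

/-! ### Unary operators -/

section Unary

theorem sub_unary (hα : SoundEncoding S E α) {φ : MITL AP}
    (h : φ.subformulas = {φ} ∪ α.subformulas) :
    ∀ ψ ∈ φ.subformulas, ψ = φ ∨ ∃ b, E.enc ψ = some b := by
  rw [h]
  rintro ψ (h | h)
  · exact Or.inl h
  · exact Or.inr (hα.1 ψ h)

theorem sound_encEvZero (hα : SoundEncoding S E α) (ha : E.enc α = some a) :
    SoundEncoding S (E.encEvZero α a) (.ev .le 0 α) := by
  refine soundEncoding_extend (sub_unary hα rfl)
    ((traces_extend_false 0 ?_ ?_ ?_).trans hα.2.1) fun τ =>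
      Run.sat_evZero (hα.approx ha τ) fun i => ?_
  · simp
  · simp [evZeroC]
  · simp
  · simpa [evZeroC] using (τ.trans i).2

theorem sound_encEvLt (hα : SoundEncoding S E α) (ha : E.enc α = some a) {n : ℕ} (hn : 0 < n) :
    SoundEncoding S (E.encEvLt n α a) (.ev .lt n α) := by
  refine soundEncoding_extend (sub_unary hα rfl)
    ((traces_extend_false 0 ?_ ?_ ?_).trans hα.2.1) fun τ => ?_
  · simp
  · simp [evC, evReset]
  · simp
  · have hT := fun i => (τ.trans i).2
    simp only [evC, evReset, evLtTime, stepSatAtom, BForm.eval, BForm.conj, cur, nxt, opn, opnN,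
      reset, adv, cd, Cmp.holds, Nat.cast_zero, and_true, gt_iff_lt] at hT
    exact Run.sat_ev (c := fun i => (τ.st i).clk (.inr 0)) (lf := τ.holds (.inr 1))
      hn (fun d h => h) (hα.approx ha τ) (fun i => τ.clk_nonneg i _) τ.init.2.2
      (fun i h => h.imp_right Or.inl) (fun i => (hT i).1) (fun i => (hT i).2.1)
      (fun i => (hT i).2.2.1) (fun i => (hT i).2.2.2.1) (fun i => (hT i).2.2.2.2)

theorem sound_encEvLe (hα : SoundEncoding S E α) (ha : E.enc α = some a) {n : ℕ} (hn : 0 < n) :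
    SoundEncoding S (E.encEvLe n α a) (.ev .le n α) := by
  refine soundEncoding_extend (sub_unary hα rfl)
    ((traces_extend_false 0 ?_ ?_ ?_).trans hα.2.1) fun τ => ?_
  · simp
  · simp [evC, evReset]
  · simp
  · have hT := fun i => (τ.trans i).2
    simp only [evC, evReset, evLeTime, stepSatAtom, BForm.eval, BForm.conj, cur, nxt, opn, opnN,
      reset, adv, cd, Cmp.holds, Nat.cast_zero, and_true, gt_iff_lt] at hT
    refine Run.sat_ev (c := fun i => (τ.st i).clk (.inr 0)) (lf := τ.holds (.inr 1))
      hn (fun d h => le_of_lt h) (hα.approx ha τ) (fun i => τ.clk_nonneg i _) τ.init.2.2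
      (fun i h => ?_) (fun i => (hT i).1) (fun i => (hT i).2.1)
      (fun i => (hT i).2.2.1) (fun i => (hT i).2.2.2.1) (fun i => (hT i).2.2.2.2)
    rcases h with h | ⟨h | h, h'⟩
    · exact Or.inl h
    -- If the next interval is a singleton, the deadline may be attained exactly, because the
    -- comparison is not strict.
    · exact Or.inr (Or.inr ⟨fun d h => h, h, h'⟩)
    · exact Or.inr (Or.inl ⟨h, h'⟩)

theorem sound_encAlwZero (hα : SoundEncoding S E α) (ha : E.enc α = some a) :
    SoundEncoding S (E.encAlwZero α a) (.alw .le 0 α) := by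
  refine soundEncoding_extend (sub_unary hα rfl)
    ((traces_extend_false 0 ?_ ?_ ?_).trans hα.2.1) fun τ =>
      Run.sat_alwZero (hα.approx ha τ) fun i => ?_
  · simp
  · simp [alwZeroC]
  · simp
  · simpa [alwZeroC] using (τ.trans i).2

theorem sound_encAlwLt (hα : SoundEncoding S E α) (ha : E.enc α = some a) {n : ℕ} :
    SoundEncoding S (E.encAlwLt n α a) (.alw .lt n α) := by
  refine soundEncoding_extend (sub_unary hα rfl)
    -- A clock starting at `n` never satisfies `c < n`, so the constraint does not demand the
    -- operand.
    ((traces_extend_false n ?_ ?_ ?_).trans hα.2.1) fun τ => ?_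
  · simp
  · intro s s' δ δ' c hc
    simp [alwC, alwLtTime, hc 0]
  · simp
  · have hT := fun i => (τ.trans i).2
    simp only [alwC, alwLtTime, stepSatAtom, BForm.eval, BForm.conj, cur, nxt, opn, reset, adv,
      Cmp.holds, Nat.cast_zero, and_true, gt_iff_lt] at hT
    refine Run.sat_alw (c := fun i => (τ.st i).clk (.inr 0)) (ri := τ.holds (.inr 1))
      (hα.approx ha τ) (fun i d hd h => ?_) (fun i => (hT i).1) (fun i => (hT i).2.1)
      (fun i => (hT i).2.2)
    rcases h with h | ⟨h, -⟩
    · exact h.trans hd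
    · exact h.trans_lt hd

theorem sound_encAlwLe (hα : SoundEncoding S E α) (ha : E.enc α = some a) {n : ℕ} :
    SoundEncoding S (E.encAlwLe n α a) (.alw .le n α) := by
  refine soundEncoding_extend (sub_unary hα rfl)
    -- The start value `n` would not do here, since the timing condition can hold at `c = n`.
    ((traces_extend_false (n + 1) ?_ ?_ ?_).trans hα.2.1) fun τ => ?_
  · simp
  · intro s s' δ δ' c hc
    have h0 : (n : ℝ) + 1 ≤ c 0 := by exact_mod_cast hc 0
    have h1 : (n : ℝ) < c 0 := by linarith
    simp [alwC, alwLeTime, h1.le, h1]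
  · simp
  · have hT := fun i => (τ.trans i).2
    simp only [alwC, alwLeTime, stepSatAtom, BForm.eval, BForm.conj, cur, nxt, opn, reset, adv,
      Cmp.holds, Nat.cast_zero, and_true, gt_iff_lt] at hT
    refine Run.sat_alw (c := fun i => (τ.st i).clk (.inr 0)) (ri := τ.holds (.inr 1))
      (hα.approx ha τ) (fun i d hd h => ?_) (fun i => (hT i).1) (fun i => (hT i).2.1)
      (fun i => (hT i).2.2)
    rcases h with h | ⟨h, h'⟩
    · exact Or.inl (h.trans_le hd)
    · exact Or.inr ⟨h.trans_le hd, h' rfl⟩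

end Unary

/-! ### Binary operators -/

section Binary

theorem sub_binary (hα : SoundEncoding S E α) (hβ : SoundEncoding S E β) {φ : MITL AP}
    (h : φ.subformulas = {φ} ∪ α.subformulas ∪ β.subformulas) :
    ∀ ψ ∈ φ.subformulas, ψ = φ ∨ ∃ b, E.enc ψ = some b := by
  rw [h]
  rintro ψ ((h | h) | h)
  · exact Or.inl h
  · exact Or.inr (hα.1 ψ h)
  · exact Or.inr (hβ.1 ψ h)

theorem sound_encAnd (hα : SoundEncoding S E α) (hβ : SoundEncoding S E β)
    (ha : E.enc α = some a) (hb : E.enc β = some b) :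
    SoundEncoding S (E.encAnd α β a b) (.and α β) := by
  refine soundEncoding_extend (sub_binary hα hβ rfl) ((traces_extend fun τ =>
    ⟨fun i _ => (τ.st i).bool a && (τ.st i).bool b, fun _ _ => 0, fun _ _ => le_rfl,
      by trivial, fun i => ?_, by simp⟩).trans hα.2.1) fun τ i hi t ht => ?_
  · simp
  · have h := (τ.trans i).2.1 hi
    exact ⟨hα.approx ha τ i h.1 t ht, hβ.approx hb τ i h.2 t ht⟩

theorem sound_encOr (hα : SoundEncoding S E α) (hβ : SoundEncoding S E β)
    (ha : E.enc α = some a) (hb : E.enc β = some b) :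
    SoundEncoding S (E.encOr α β a b) (.or α β) := by
  refine soundEncoding_extend (sub_binary hα hβ rfl) ((traces_extend fun τ =>
    ⟨fun i _ => (τ.st i).bool a || (τ.st i).bool b, fun _ _ => 0, fun _ _ => le_rfl,
      by trivial, fun i => ?_, by simp⟩).trans hα.2.1) fun τ i hi t ht => ?_
  · simp
  · exact ((τ.trans i).2.1 hi).imp (fun h => hα.approx ha τ i h t ht)
      fun h => hβ.approx hb τ i h t ht

theorem sound_encSUntil (hα : SoundEncoding S E α) (hβ : SoundEncoding S E β)
    (ha : E.enc α = some a) (hb : E.enc β = some b) :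
    SoundEncoding S (E.encSUntil α β a b) (.suntil α β) := by
  refine soundEncoding_extend (sub_binary hα hβ rfl)
    ((traces_extend_false 0 ?_ ?_ ?_).trans hα.2.1) fun τ => ?_
  · simp
  · simp [untilC]
  · simp
  · have hT := fun i => (τ.trans i).2
    simp only [untilC, stepSatAtom, BForm.eval, BForm.conj, cur, nxt, opn, opnN, Cmp.holds,
      Nat.cast_zero, and_true, gt_iff_lt] at hT
    exact Run.sat_suntil (hα.approx ha τ) (hβ.approx hb τ) (fun i => (hT i).1)
      (fun i => (hT i).2) (τ.fair _ (List.mem_append_right _ (List.mem_singleton_self _)))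

theorem sound_encUntilGe (hα : SoundEncoding S E α) (hβ : SoundEncoding S E β)
    (ha : E.enc α = some a) (hb : E.enc β = some b) (n : ℕ) :
    SoundEncoding S (E.encUntilGe n α β a b) (.until .ge n α β) := by
  refine soundEncoding_extend (sub_binary hα hβ rfl)
    ((traces_extend_false 0 ?_ ?_ ?_).trans hα.2.1) fun τ => ?_
  · simp
  · intro s s' δ δ' c hc
    rcases n.eq_zero_or_pos with hn | hn <;> simp [untilLowC, hn]
  · simp
  · have hT := fun i => (τ.trans i).2
    simp only [untilLowC, untilGeTime, untilGeTimeN, stepSatAtom, BForm.eval, BForm.conj, cur,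
      nxt, opn, opnN, reset, adv, cd, cdN, Cmp.holds, Nat.cast_zero, and_true, gt_iff_lt] at hT
    refine Run.sat_untilLow (c := fun i => (τ.st i).clk (.inr 0)) (ri := τ.holds (.inr 2))
      (fun d h => le_of_lt h) (hα.approx ha τ) (hβ.approx hb τ) (fun i h => ?_)
      (fun i => (hT i).1) (fun hn i => ?_) (fun i => (hT i).2.2.1) (fun i => (hT i).2.2.2.1)
      (fun i => (hT i).2.2.2.2.1) (fun i => (hT i).2.2.2.2.2)
      (τ.fair _ (List.mem_append_right _ (List.mem_singleton_self _)))
    · rcases h with h | ⟨h | h, h'⟩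
      · exact Or.inl h
      · exact Or.inr (Or.inl ⟨h, h'⟩)
      · exact Or.inr (Or.inr ⟨fun d h => h, h, h'⟩)
    · simpa [hn] using (hT i).2.1

theorem sound_encUntilGt (hα : SoundEncoding S E α) (hβ : SoundEncoding S E β)
    (ha : E.enc α = some a) (hb : E.enc β = some b) (n : ℕ) :
    SoundEncoding S (E.encUntilGt n α β a b) (.until .gt n α β) := by
  refine soundEncoding_extend (sub_binary hα hβ rfl)
    ((traces_extend_false 0 ?_ ?_ ?_).trans hα.2.1) fun τ => ?_
  · simp
  · intro s s' δ δ' c hc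
    rcases n.eq_zero_or_pos with hn | hn <;> simp [untilLowC, hn]
  · simp
  · have hT := fun i => (τ.trans i).2
    simp only [untilLowC, untilGtTime, untilGtTimeN, stepSatAtom, BForm.eval, BForm.conj, cur,
      nxt, opn, opnN, reset, adv, cd, cdN, Cmp.holds, Nat.cast_zero, and_true, gt_iff_lt] at hT
    refine Run.sat_untilLow (c := fun i => (τ.st i).clk (.inr 0)) (ri := τ.holds (.inr 2))
      (fun d h => h) (hα.approx ha τ) (hβ.approx hb τ) (fun i h => h.imp_right Or.inl)
      (fun i => (hT i).1) (fun hn i => ?_) (fun i => (hT i).2.2.1) (fun i => (hT i).2.2.2.1)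
      (fun i => (hT i).2.2.2.2.1) (fun i => (hT i).2.2.2.2.2)
      (τ.fair _ (List.mem_append_right _ (List.mem_singleton_self _)))
    simpa [hn] using (hT i).2.1

theorem sound_encSRelease (hα : SoundEncoding S E α) (hβ : SoundEncoding S E β)
    (ha : E.enc α = some a) (hb : E.enc β = some b) :
    SoundEncoding S (E.encSRelease α β a b) (.srelease α β) := by
  refine soundEncoding_extend (sub_binary hα hβ rfl)
    ((traces_extend_false 0 ?_ ?_ ?_).trans hα.2.1) fun τ => ?_
  · simp
  · simp [releaseC]
  · simp
  · have hT := fun i => (τ.trans i).2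
    simp only [releaseC, stepSatAtom, BForm.eval, BForm.conj, cur, nxt, opn, Cmp.holds,
      Nat.cast_zero, and_true, gt_iff_lt] at hT
    exact Run.sat_srelease (ob := τ.holds (.inr 1)) (hα.approx ha τ) (hβ.approx hb τ)
      (fun i => (hT i).1) (fun i => (hT i).2.1) (fun i => (hT i).2.2.1) (fun i => (hT i).2.2.2)

theorem sound_encReleaseGe (hα : SoundEncoding S E α) (hβ : SoundEncoding S E β)
    (ha : E.enc α = some a) (hb : E.enc β = some b) (n : ℕ) :
    SoundEncoding S (E.encReleaseGe n α β a b) (.release .ge n α β) := by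
  refine soundEncoding_extend (sub_binary hα hβ rfl)
    ((traces_extend_false 0 ?_ ?_ ?_).trans hα.2.1) fun τ => ?_
  · simp
  · simp [releaseLowC, releaseReset, releaseDelay]
  · simp
  · have hT := fun i => (τ.trans i).2
    simp only [releaseLowC, releaseReset, releaseDelay, releaseGeTime, stepSatAtom, BForm.eval,
      BForm.conj, cur, nxt, opn, opnN, reset, adv, cd, Cmp.holds, Nat.cast_zero, and_true,
      gt_iff_lt] at hT
    exact Run.sat_releaseLow (ob := τ.holds (.inr 1)) (lf := τ.holds (.inr 2))
      (c := fun i => (τ.st i).clk (.inr 0)) (fun d h => h) (hα.approx ha τ) (hβ.approx hb τ)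
      (fun i => τ.clk_nonneg i _) τ.init.2.2 (fun i h => Or.inl h)
      (fun i h1 h2 h3 => Or.inr ⟨h1, h2, h3⟩) (fun i => (hT i).1) (fun i => (hT i).2.1)
      (fun i => (hT i).2.2.1) (fun i => (hT i).2.2.2.1) (fun i => (hT i).2.2.2.2.1)
      (fun i => (hT i).2.2.2.2.2.1) (fun i => (hT i).2.2.2.2.2.2.1)
      (fun i => (hT i).2.2.2.2.2.2.2)

theorem sound_encReleaseGt (hα : SoundEncoding S E α) (hβ : SoundEncoding S E β)
    (ha : E.enc α = some a) (hb : E.enc β = some b) (n : ℕ) :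
    SoundEncoding S (E.encReleaseGt n α β a b) (.release .gt n α β) := by
  refine soundEncoding_extend (sub_binary hα hβ rfl)
    ((traces_extend_false 0 ?_ ?_ ?_).trans hα.2.1) fun τ => ?_
  · simp
  · simp [releaseLowC, releaseReset, releaseDelay]
  · simp
  · have hT := fun i => (τ.trans i).2
    simp only [releaseLowC, releaseReset, releaseDelay, releaseGtTime, stepSatAtom, BForm.eval,
      BForm.conj, cur, nxt, opn, opnN, reset, adv, cd, Cmp.holds, Nat.cast_zero, and_true,
      gt_iff_lt] at hT
    exact Run.sat_releaseLow (ob := τ.holds (.inr 1)) (lf := τ.holds (.inr 2))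
      (c := fun i => (τ.st i).clk (.inr 0)) (fun d h => le_of_lt h) (hα.approx ha τ)
      (hβ.approx hb τ) (fun i => τ.clk_nonneg i _) τ.init.2.2 (fun i h => h)
      (fun i _ _ h => h) (fun i => (hT i).1) (fun i => (hT i).2.1)
      (fun i => (hT i).2.2.1) (fun i => (hT i).2.2.2.1) (fun i => (hT i).2.2.2.2.1)
      (fun i => (hT i).2.2.2.2.2.1) (fun i => (hT i).2.2.2.2.2.2.1)
      (fun i => (hT i).2.2.2.2.2.2.2)

end Binary

end EncSys

theorem mainTheorem1 {AP : Type*} :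
    (∀ (E : EncSys AP) (p : AP),
      SoundEncoding E.toTransSys (E.encAtom p) (.atom p) ∧
      SoundEncoding E.toTransSys (E.encNegAtom p) (.negAtom p)) ∧
    (∀ (S : TransSys AP) (E : EncSys AP) (α : MITL AP) (a : E.sig.B),
      SoundEncoding S E α → E.enc α = some a →
        SoundEncoding S (E.encEvZero α a) (.ev .le 0 α) ∧
        (∀ n : ℕ, 0 < n → SoundEncoding S (E.encEvLt n α a) (.ev .lt n α)) ∧
        (∀ n : ℕ, 0 < n → SoundEncoding S (E.encEvLe n α a) (.ev .le n α)) ∧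
        SoundEncoding S (E.encAlwZero α a) (.alw .le 0 α) ∧
        (∀ n : ℕ, 0 < n → SoundEncoding S (E.encAlwLt n α a) (.alw .lt n α)) ∧
        (∀ n : ℕ, 0 < n → SoundEncoding S (E.encAlwLe n α a) (.alw .le n α))) ∧
    (∀ (S : TransSys AP) (E : EncSys AP) (α β : MITL AP) (a b : E.sig.B),
      SoundEncoding S E α → SoundEncoding S E β → E.enc α = some a → E.enc β = some b →
        SoundEncoding S (E.encAnd α β a b) (.and α β) ∧
        SoundEncoding S (E.encOr α β a b) (.or α β) ∧
        SoundEncoding S (E.encSUntil α β a b) (.suntil α β) ∧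
        (∀ n : ℕ, SoundEncoding S (E.encUntilGe n α β a b) (.until .ge n α β)) ∧
        (∀ n : ℕ, SoundEncoding S (E.encUntilGt n α β a b) (.until .gt n α β)) ∧
        SoundEncoding S (E.encSRelease α β a b) (.srelease α β) ∧
        (∀ n : ℕ, SoundEncoding S (E.encReleaseGe n α β a b) (.release .ge n α β)) ∧
        (∀ n : ℕ, SoundEncoding S (E.encReleaseGt n α β a b) (.release .gt n α β))) :=
  open EncSys in
  ⟨fun _ p => ⟨sound_encAtom p, sound_encNegAtom p⟩,
    fun _ _ _ _ hα ha => ⟨sound_encEvZero hα ha, fun _ hn => sound_encEvLt hα ha hn,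
      fun _ hn => sound_encEvLe hα ha hn, sound_encAlwZero hα ha,
      fun _ _ => sound_encAlwLt hα ha, fun _ _ => sound_encAlwLe hα ha⟩,
    fun _ _ _ _ _ _ hα hβ ha hb => ⟨sound_encAnd hα hβ ha hb, sound_encOr hα hβ ha hb,
      sound_encSUntil hα hβ ha hb, sound_encUntilGe hα hβ ha hb, sound_encUntilGt hα hβ ha hb,
      sound_encSRelease hα hβ ha hb, sound_encReleaseGe hα hβ ha hb,
      sound_encReleaseGt hα hβ ha hb⟩⟩
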